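/- **Setting.** Let $k$ be a field. The bipath poset $B$ is the set $(\mathbb R\times\{1,2\})\sqcup\{-\infty,+\infty\}$ with $x\le y$ if and only if $x=-\infty$, or $y=+\infty$, or $x=(s,i)$, $y=(t,i)$ with the same $i$ and $s\le t$. For $\epsilon\ge 0$ let $\Lambda_\epsilon\colon B\to B$ be the translation $(r,i)\mapsto(r+\epsilon,i)$, $\pm\infty\mapsto\pm\infty$. A pfd bipath persistence module is a functor $V$ from $B$ to $k$-vector spaces with every $V_b$ finite-dimensional; $V(\epsilon)$ denotes the module $b\mapsto V_{\Lambda_\epsilon(b)}$, and $V_{0\to\epsilon}\colon V\to V(\epsilon)$ the morphism given by the structure maps of $V$. $V$ is $\Lambda_\epsilon$-trivial if $V_{0\to\epsilon}=0$. An interval of $B$ is a non-empty, convex, connected subset $I\subseteq B$; $k_I$ is the module equal to $k$ on $I$ and $0$ elsewhere, with identity structure maps inside $I$. $\mathscr B(V)$ denotes the multiset of indecomposable summands of $V$ in a decomposition of $V$ as a direct sum of indecomposable modules. When the summands are interval modules, $\mathscr B(V)$ is also regarded as a multiset of intervals. For $A\subseteq B$ non-empty, put $\mathrm{Ex}_\epsilon(A)=\{b\mid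 \exists a\in \Lambda_\epsilon^{-1}(A),\ a\le b\}\cap\{b\mid\exists a\in\Lambda_\epsilon(A),\ b\le a\}$. A partial matching between two multisets is a bijection between a sub-multiset of the first and a sub-multiset of the second. * A $\Lambda_\epsilon$-interleaving between $V$ and $W$ is a pair of morphisms $\alpha\colon V\to W(\epsilon)$, $\beta\colon W\to V(\epsilon)$ with $\beta(\epsilon)\circ\alpha=V_{0\to2\epsilon}$ and $\alpha(\epsilon)\circ\beta=W_{0\to2\epsilon}$. * A bottleneck $\Lambda_\epsilon$-interleaving between $V$ and $W$ is a partial matching between the multisets $\mathscr B(V)$ and $\mathscr B(W)$ of indecomposable modules such that all unmatched modules are $\Lambda_{2\epsilon}$-trivial and matched modules are $\Lambda_\epsilon$-interleaved (i.e. there is a $\Lambda_\epsilon$-interleaving between them). * A $\Lambda_\epsilon$-matching between multisets of intervals is a partial matching such that $k_I$ is $\Lambda_{2\epsilon}$-trivial for every unmatched interval $I$, and $I\subseteq\mathrm{Ex}_\epsilon(J)$, $J\subseteq \mathrm{Ex}_\epsilon(I)$ whenever $I$ is matched with $J$. The distances $d_{\mathrm I}(V,W)$, $d_{\mathrm{BI}}(V,W)$,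 $d_{\mathrm B}(\mathscr B(V),\mathscr B(W))\in[0,\infty]$ are the infima of the $\epsilon\ge0$ for which there is, respectively, a $\Lambda_\epsilon$-interleaving between $V$ and $W$, a bottleneck $\Lambda_\epsilon$-interleaving between $V$ and $W$, and a $\Lambda_\epsilon$-matching between $\mathscr B(V)$ and $\mathscr B(W)$ (with $\inf\emptyset=\infty$). **Theorem.** Let $V$ and $W$ be pfd bipath persistence modules. Then $V$ and $W$ are direct sums of interval modules (which are indecomposable), each interval occurring with finite multiplicity, so that $\mathscr B(V)$ and $\mathscr B(W)$ can be regarded as multisets of intervals. For every choice of the multisets $\mathscr B(V)$ and $\mathscr B(W)$ and every $\epsilon\ge0$ the following are equivalent: (a) there is a $\Lambda_\epsilon$-matching between the multisets of intervals $\mathscr B(V)$ and $\mathscr B(W)$; (b) there is a bottleneck $\Lambda_\epsilon$-interleaving between $V$ and $W$; (c) there is a $\Lambda_\epsilon$-interleaving between $V$ and $W$. Consequently $d_{\mathrm I}(V,W)=d_{\mathrm{BI}}(V,W)=d_{\mathrm B}(\mathscr B(V),\mathscr B(W))$. -/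

import Mathlib

open CategoryTheory
open scoped NNReal ENNReal

universe u v w w'

noncomputable section

namespace Bipath

/-! ### Persistence modules and direct sum decompositions -/

/-- Persistence modules over a poset `P` with coefficients in `k`: functors from `P` (regarded as a
category) to `k`-vector spaces. -/
abbrev PersMod (k : Type u) [Field k] (P : Type v) [PartialOrder P] := P ⥤ ModuleCat.{u} k

section Modules

variable {k : Type u} [Field k] {P : Type v} [PartialOrder P]

/-- Pointwise finite-dimensional persistence modules. -/
def IsPfd (V : PersMod k P) : Prop := ∀ p : P, Module.Finite k (V.obj p)

open Classical in
/-- `V` is isomorphic to the direct sum of the family `M`: there are morphisms `M i ⟶ V` which at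
every point `p` induce a bijection `⨁ i, (M i)_p → V_p`. -/
def IsDirectSum (V : PersMod k P) {ι : Type w} (M : ι → PersMod k P) : Prop :=
  ∃ inj : ∀ i, M i ⟶ V, ∀ p : P, Function.Bijective
    (DirectSum.toModule k ι (V.obj p) fun i => ((inj i).app p).hom :
      (DirectSum ι fun i => (M i).obj p) →ₗ[k] V.obj p)

/-- The family `M` is a decomposition of `V` into indecomposables, i.e. (a choice of
representatives of) the multiset `𝓑(V)` of indecomposable summands of `V`. -/
def IsDecomposition (V : PersMod k P) {ι : Type w} (M : ι → PersMod k P) : Prop :=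
  (∀ i, Indecomposable (M i)) ∧ IsDirectSum V M

end Modules

/-! ### Intervals and interval modules -/

/-- Intervals of a poset: non-empty, convex, connected subsets. -/
structure PosetInterval (P : Type v) [PartialOrder P] where
  carrier : Set P
  nonempty : carrier.Nonempty
  convex : ∀ p ∈ carrier, ∀ q ∈ carrier, ∀ r, p ≤ r → r ≤ q → r ∈ carrier
  connected : ∀ p ∈ carrier, ∀ q ∈ carrier,
    Relation.ReflTransGen (fun a b => a ∈ carrier ∧ b ∈ carrier ∧ (a ≤ b ∨ b ≤ a)) p q

section IntervalModule

variable (k : Type u) [Field k] {P : Type v} [PartialOrder P]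

open Classical in
/-- The space of the interval module at `p`: the line `k` if `p ∈ I`, and `0` otherwise. -/
def intervalSpace (I : PosetInterval P) (p : P) : Submodule k k :=
  if p ∈ I.carrier then ⊤ else ⊥

variable {k} in
theorem intervalSpace_mem {I : PosetInterval P} {p : P} {x : k} :
    x ∈ intervalSpace k I p ↔ (p ∉ I.carrier → x = 0) := by
  unfold intervalSpace
  split_ifs with h <;> simp [h]

open Classical in
/-- The structure map of the interval module: the identity of `k` if `p, q ∈ I`, and `0`
otherwise. -/
def intervalMap (I : PosetInterval P) (p q : P) : intervalSpace k I p →ₗ[k] intervalSpace k I q where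
  toFun x := if h : p ∈ I.carrier ∧ q ∈ I.carrier then
    ⟨x.1, intervalSpace_mem.2 fun hq => absurd h.2 hq⟩ else 0
  map_add' x y := by split_ifs <;> simp
  map_smul' c x := by split_ifs <;> simp

open Classical in
theorem intervalMap_val (I : PosetInterval P) (p q : P) (x : intervalSpace k I p) :
    (intervalMap k I p q x : k) = if p ∈ I.carrier ∧ q ∈ I.carrier then x.1 else 0 := by
  simp only [intervalMap, LinearMap.coe_mk, AddHom.coe_mk]
  split_ifs <;> rfl

/-- The interval module `k_I`. -/
def intervalModule (I : PosetInterval P) : PersMod k P where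
  obj p := ModuleCat.of k (intervalSpace k I p)
  map {p q} _ := ModuleCat.ofHom (intervalMap k I p q)
  map_id p := by
    ext x
    have hx := intervalSpace_mem.1 x.2
    change (intervalMap k I p p x : k) = x.1
    rw [intervalMap_val]
    split_ifs with h
    · rfl
    · exact (hx fun hp => h ⟨hp, hp⟩).symm
  map_comp {p q r} f g := by
    ext x
    have hx := intervalSpace_mem.1 x.2
    change (intervalMap k I p r x : k) = (intervalMap k I q r (intervalMap k I p q x) : k)
    rw [intervalMap_val, intervalMap_val, intervalMap_val]
    have hq := fun hp hr => I.convex p hp r hr q (leOfHom f) (leOfHom g)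
    by_cases hp : p ∈ I.carrier <;> by_cases hr : r ∈ I.carrier <;> simp_all

end IntervalModule

/-! ### Multisets of intervals (barcodes) -/

/-- Multisets of intervals (with finite multiplicities, but possibly infinitely many intervals),
given by their multiplicity functions. -/
abbrev Barcode (P : Type v) [PartialOrder P] := PosetInterval P → ℕ

/-- The elements of a multiset of intervals, counted with multiplicity. -/
abbrev Barcode.Elem {P : Type v} [PartialOrder P] (A : Barcode P) : Type v :=
  Σ I : PosetInterval P, Fin (A I)

/-- The multiset of intervals `A` is the barcode of `V`:
`V` is the direct sum of the (indecomposable) modules `k_I`, each taken `A I` times. -/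
def IsBarcode {k : Type u} [Field k] {P : Type v} [PartialOrder P]
    (V : PersMod k P) (A : Barcode P) : Prop :=
  IsDecomposition V fun x : A.Elem => intervalModule k x.1

/-! ### Actions of the non-negative reals, interleavings and matchings -/

/-- An action of `(ℝ≥0, +)` on a poset by translations. -/
structure PosetAction (P : Type v) [PartialOrder P] where
  shift : ℝ≥0 → P →o P
  le_shift : ∀ ε p, p ≤ shift ε p
  shift_zero : ∀ p, shift 0 p = p
  shift_shift : ∀ ε ζ p, shift ε (shift ζ p) = shift (ε + ζ) p

section Interleaving

variable {k : Type u} [Field k] {P : Type v} [PartialOrder P] (Λ : PosetAction P)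

/-- The shifted module `V(ε)`, with `V(ε)_p = V_{Λ_ε(p)}`. -/
def shiftModule (ε : ℝ≥0) (V : PersMod k P) : PersMod k P :=
  (Λ.shift ε).monotone.functor ⋙ V

/-- `V` and `W` are `Λ_ε`-interleaved: there are morphisms `α : V ⟶ W(ε)` and `β : W ⟶ V(ε)` such
that `β(ε) ∘ α` and `α(ε) ∘ β` are the structure maps from `p` to `Λ_ε(Λ_ε(p)) = Λ_{2ε}(p)` of `V`
and of `W`, respectively. -/
def Interleaved (ε : ℝ≥0) (V W : PersMod k P) : Prop :=
  ∃ (α : V ⟶ shiftModule Λ ε W) (β : W ⟶ shiftModule Λ ε V),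
    (∀ p, (α.app p ≫ β.app (Λ.shift ε p) : V.obj p ⟶ V.obj (Λ.shift ε (Λ.shift ε p))) =
      V.map (homOfLE ((Λ.le_shift ε p).trans (Λ.le_shift ε _)))) ∧
    (∀ p, (β.app p ≫ α.app (Λ.shift ε p) : W.obj p ⟶ W.obj (Λ.shift ε (Λ.shift ε p))) =
      W.map (homOfLE ((Λ.le_shift ε p).trans (Λ.le_shift ε _))))

/-- `V` is `Λ_ε`-trivial: the canonical morphism `V ⟶ V(ε)` is zero. -/
def IsTrivial (ε : ℝ≥0) (V : PersMod k P) : Prop :=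
  ∀ p, V.map (homOfLE (Λ.le_shift ε p)) = 0

/-- The interleaving distance, with values in `[0, ∞]`. -/
def interleavingDist (V W : PersMod k P) : ℝ≥0∞ :=
  ⨅ (ε : ℝ≥0) (_ : Interleaved Λ ε V W), (ε : ℝ≥0∞)

/-- There is a bottleneck `Λ_ε`-interleaving between the multisets `M` and `N` of modules: a
partial matching `σ` (a bijection between subsets of the index types) such that unmatched
modules are `Λ_{2ε}`-trivial and matched modules are `Λ_ε`-interleaved. -/
def BottleneckInterleaved (ε : ℝ≥0) {ι : Type w} {κ : Type w'}
    (M : ι → PersMod k P) (N : κ → PersMod k P) : Prop :=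
  ∃ σ : ι ≃. κ,
    (∀ i, σ i = none → IsTrivial Λ (2 * ε) (M i)) ∧
    (∀ j, σ.symm j = none → IsTrivial Λ (2 * ε) (N j)) ∧
    (∀ i j, σ i = some j → Interleaved Λ ε (M i) (N j))

/-- The bottleneck interleaving distance between modules with indecomposable summands `M` and `N`,
with values in `[0, ∞]`. -/
def bottleneckInterleavingDist {ι : Type w} {κ : Type w'}
    (M : ι → PersMod k P) (N : κ → PersMod k P) : ℝ≥0∞ :=
  ⨅ (ε : ℝ≥0) (_ : BottleneckInterleaved Λ ε M N), (ε : ℝ≥0∞)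

/-- The upset generated by `A`, with the convention that the empty set generates everything. -/
def up (A : Set P) : Set P := {p | A.Nonempty → ∃ a ∈ A, a ≤ p}

/-- The downset generated by `A`, with the convention that the empty set generates everything. -/
def down (A : Set P) : Set P := {p | A.Nonempty → ∃ a ∈ A, p ≤ a}

/-- The `Λ_ε`-thickening of a subset. -/
def thickening (ε : ℝ≥0) (A : Set P) : Set P :=
  up (Λ.shift ε ⁻¹' A) ∩ down (Λ.shift ε '' A)

variable (k) in
/-- There is a `Λ_ε`-matching between the multisets of intervals `A` and `C`: a partial matching
such that the interval modules of unmatched intervals are `Λ_{2ε}`-trivial and matched intervals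
lie in the `Λ_ε`-thickenings of each other. -/
def Matched (ε : ℝ≥0) (A C : Barcode P) : Prop :=
  ∃ σ : A.Elem ≃. C.Elem,
    (∀ x, σ x = none → IsTrivial Λ (2 * ε) (intervalModule k x.1)) ∧
    (∀ y, σ.symm y = none → IsTrivial Λ (2 * ε) (intervalModule k y.1)) ∧
    (∀ x y, σ x = some y → x.1.carrier ⊆ thickening Λ ε y.1.carrier ∧
      y.1.carrier ⊆ thickening Λ ε x.1.carrier)

variable (k) in
/-- The bottleneck distance between multisets of intervals, with values in `[0, ∞]`. -/
def bottleneckDist (A C : Barcode P) : ℝ≥0∞ :=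
  ⨅ (ε : ℝ≥0) (_ : Matched k Λ ε A C), (ε : ℝ≥0∞)

end Interleaving

/-! ### The bipath poset and its action -/

/-- The underlying set of the bipath poset: two copies of the real line (indexed by `Fin 2`)
together with `-∞` and `+∞`. -/
inductive Pt : Type
  | negInf : Pt
  | posInf : Pt
  | real : ℝ → Fin 2 → Pt

/-- The order of the bipath poset: `x = -∞`, or `y = +∞`, or `x ≤ y` in the same real line. -/
def Pt.Le (x y : Pt) : Prop :=
  x = .negInf ∨ y = .posInf ∨ ∃ s t i, x = .real s i ∧ y = .real t i ∧ s ≤ t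

instance : PartialOrder Pt where
  le := Pt.Le
  le_refl x := by
    cases x with
    | negInf => exact Or.inl rfl
    | posInf => exact Or.inr (Or.inl rfl)
    | real s i => exact Or.inr (Or.inr ⟨s, s, i, rfl, rfl, le_rfl⟩)
  le_trans x y z hxy hyz := by
    rcases hxy with rfl | rfl | ⟨s, t, i, rfl, rfl, hst⟩
    · exact Or.inl rfl
    · rcases hyz with h | rfl | ⟨_, _, _, h, _⟩
      · cases h
      · exact Or.inr (Or.inl rfl)
      · cases h
    · rcases hyz with h | rfl | ⟨t, r, j, h, rfl, htr⟩
      · cases h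
      · exact Or.inr (Or.inl rfl)
      · cases h
        exact Or.inr (Or.inr ⟨s, r, i, rfl, rfl, hst.trans htr⟩)
  le_antisymm x y hxy hyx := by
    rcases hxy with rfl | rfl | ⟨s, t, i, rfl, rfl, hst⟩
    · rcases hyx with rfl | h | ⟨_, _, _, _, h, _⟩
      · rfl
      · cases h
      · cases h
    · rcases hyx with h | rfl | ⟨_, _, _, h, _⟩
      · cases h
      · rfl
      · cases h
    · rcases hyx with h | h | ⟨t', s', j, h, h', hts⟩
      · cases h
      · cases h
      · cases h
        cases h'
        rw [le_antisymm hst hts]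

/-- The translation by `ε`: it moves both real lines by `ε` and fixes `-∞` and `+∞`. -/
def Pt.translate (ε : ℝ≥0) : Pt → Pt
  | .negInf => .negInf
  | .posInf => .posInf
  | .real r i => .real (r + ε) i

theorem Pt.translate_monotone (ε : ℝ≥0) : Monotone (Pt.translate ε) := by
  intro x y hxy
  rcases hxy with rfl | rfl | ⟨s, t, i, rfl, rfl, hst⟩
  · exact Or.inl rfl
  · exact Or.inr (Or.inl rfl)
  · exact Or.inr (Or.inr ⟨s + ε, t + ε, i, rfl, rfl, by linarith⟩)

theorem Pt.le_translate (ε : ℝ≥0) (p : Pt) : p ≤ Pt.translate ε p := by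
  cases p with
  | negInf => exact Or.inl rfl
  | posInf => exact Or.inr (Or.inl rfl)
  | real s i => exact Or.inr (Or.inr ⟨s, s + ε, i, rfl, rfl, le_add_of_nonneg_right ε.2⟩)

theorem Pt.translate_zero (p : Pt) : Pt.translate 0 p = p := by
  cases p <;> simp [Pt.translate]

theorem Pt.translate_translate (ε ζ : ℝ≥0) (p : Pt) :
    Pt.translate ε (Pt.translate ζ p) = Pt.translate (ε + ζ) p := by
  cases p with
  | negInf => rfl
  | posInf => rfl
  | real s i =>
    simp only [Pt.translate, NNReal.coe_add, Pt.real.injEq, and_true]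
    ring

/-- The action of the non-negative reals on the bipath poset by translations. -/
def bipathAction : PosetAction Pt where
  shift ε := ⟨Pt.translate ε, Pt.translate_monotone ε⟩
  le_shift := Pt.le_translate
  shift_zero := Pt.translate_zero
  shift_shift := Pt.translate_translate

end Bipath

end

/-! Decomposition. A nonzero pfd module has an interval summand. If it is nonzero at one of the two
infinite points, take `b` to be that point; otherwise take `b` on one of the lines. In either case
only two chains of subspaces of `V_b` matter: the kernels along the two lines, the images along the
two lines, or the kernels and the images along one line. For two chains in a finite-dimensional
space there are a vector `e` and a functional `ξ` with `ξ e = 1` such that every member of either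
chain contains `e` or is killed by `ξ` (`exists_vector_functional`). This makes `ξ` extend to where
`e` survives and `e` lift to where `ξ` survives, which gives a summand
(`exists_intervalSummand_of_star`). A maximal orthogonal family of such summands is a basis, by
Zorn's lemma.

From matchings to interleavings. When two intervals lie in each other's thickenings, the identities
of `k`, wherever both sides are nonzero, interleave their interval modules. Interleavings of matched
summands add up, with zero on the unmatched ones.

From interleavings to matchings. Interval bases of `V` and `W` turn an interleaving into a pair of
matrices. Only entries between intervals of the same type count. Within a type an interval is
determined by two cuts of the real line: where it stops on the two lines if it contains an infinite
point, its lower and upper ends otherwise. A nonzero entry from `I` to `J` forces each end of `J` to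
be at most the same end of `I` plus `ε` (`endsLE_of_coef_ne_zero`). Let the score be the sum of the
two ends. If nonzero entries lead from `I` to `J` to `K` and the score of `I` is at most that of
`K`, then `J` is close to `I` or to `K` (`endsLE_or_endsLE`).

Hence, for a finite set `S` of intervals of `V` containing a point and its `2ε`-translate, the
product of the two matrices is still unitriangular for the score when the middle index runs only
over the intervals of `W` close to some member of `S` (`sum_entry_mul_entry`). There are then at
least as many of these as members of `S`, which is Hall's condition, so the long intervals of `V`
inject into close intervals of `W`. The symmetric statement and a Schröder–Bernstein argument give
one partial matching covering the long intervals of both sides. At `ε = 0` the same result shows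
that the barcode is unique. -/

noncomputable section

namespace Bipath

/-! ### Matchings in relations -/

open Classical in
/-- Extend a map defined on a subset by sending the rest to an infinite reservoir. -/
def reservoirMap {X : Type*} {Y : Type*} {Z : Type*} {X₀ : Set X} (f : X₀ → Y) (τ : X → Z) :
    X ⊕ (Z × ℕ) → Y ⊕ (Z × ℕ) :=
  Sum.elim (fun x => if h : x ∈ X₀ then Sum.inl (f ⟨x, h⟩) else Sum.inr (τ x, 0))
    (fun d => Sum.inr (d.1, d.2 + 1))

theorem reservoirMap_injective {X : Type*} {Y : Type*} {Z : Type*} {X₀ : Set X} {f : X₀ → Y}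
    {τ : X → Z} (hf : Function.Injective f) (hτ : Function.Injective τ) :
    Function.Injective (reservoirMap f τ) := by
  rintro (x | d) (x' | d') h
  · by_cases h1 : x ∈ X₀ <;> by_cases h2 : x' ∈ X₀ <;> simp [reservoirMap, h1, h2] at h
    · have := hf h
      simpa using this
    · exact congrArg _ (hτ h)
  · by_cases h1 : x ∈ X₀ <;> simp [reservoirMap, h1] at h
  · by_cases h1 : x' ∈ X₀ <;> simp [reservoirMap, h1] at h
  · simp only [reservoirMap, Sum.elim_inr, Sum.inr.injEq, Prod.mk.injEq, add_left_inj] at h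
    exact congrArg _ (Prod.ext h.1 h.2)

/-- If two injections cover subsets `X₀` and `Y₀` of the two sides of a relation, then a partial
matching inside the relation covers both of them. -/
theorem exists_pequiv_of_injOn {X : Type w} {Y : Type w'} (R : X → Y → Prop) (X₀ : Set X)
    (Y₀ : Set Y) (f : X₀ → Y) (hf : Function.Injective f) (hfR : ∀ x : X₀, R x (f x))
    (g : Y₀ → X) (hg : Function.Injective g) (hgR : ∀ y : Y₀, R (g y) y) :
    ∃ σ : X ≃. Y, (∀ x, σ x = none → x ∉ X₀) ∧ (∀ y, σ.symm y = none → y ∉ Y₀) ∧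
      ∀ x y, σ x = some y → R x y := by
  classical
  -- Pairing with a reservoir element means staying unmatched, which is permitted only outside `X₀`
  -- and `Y₀`. Both extended injections respect `Q`, so the Schröder–Bernstein bijection does too.
  let Q : X ⊕ ((X ⊕ Y) × ℕ) → Y ⊕ ((X ⊕ Y) × ℕ) → Prop := fun a b => match a, b with
    | .inl x, .inl y => R x y
    | .inl x, .inr _ => x ∉ X₀
    | .inr _, .inl y => y ∉ Y₀
    | .inr _, .inr _ => True
  obtain ⟨H, hH, hHQ⟩ := Function.Embedding.schroeder_bernstein_of_rel
    (reservoirMap_injective hf (Sum.inl_injective (β := Y)))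
    (reservoirMap_injective hg (Sum.inr_injective (α := X))) Q
    (by
      rintro (x | d)
      · by_cases h : x ∈ X₀
        · simpa [reservoirMap, Q, h] using hfR ⟨x, h⟩
        · simp [reservoirMap, Q, h]
      · simp [reservoirMap, Q])
    (by
      rintro (y | d)
      · by_cases h : y ∈ Y₀
        · simpa [reservoirMap, Q, h] using hgR ⟨y, h⟩
        · simp [reservoirMap, Q, h]
      · simp [reservoirMap, Q])
  let e := Equiv.ofBijective H hH
  have he : ∀ a, Q a (e a) := hHQ
  have he' : ∀ b, Q (e.symm b) b := fun b => by simpa using he (e.symm b)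
  refine ⟨⟨fun x => (e (Sum.inl x)).getLeft?, fun y => (e.symm (Sum.inl y)).getLeft?, ?_⟩,
    ?_, ?_, ?_⟩
  · intro x y
    simp only [Sum.getLeft?_eq_some_iff]
    rw [Equiv.symm_apply_eq, eq_comm]
  · intro x hx
    have hx' : (e (Sum.inl x)).getLeft? = none := hx
    rw [Sum.getLeft?_eq_none_iff, Sum.isRight_iff] at hx'
    obtain ⟨d, hd⟩ := hx'
    have := he (Sum.inl x)
    rw [hd] at this
    exact this
  · intro y hy
    have hy' : (e.symm (Sum.inl y)).getLeft? = none := hy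
    rw [Sum.getLeft?_eq_none_iff, Sum.isRight_iff] at hy'
    obtain ⟨d, hd⟩ := hy'
    have := he' (Sum.inl y)
    rw [hd] at this
    exact this
  · intro x y hxy
    have hx' : (e (Sum.inl x)).getLeft? = some y := hxy
    rw [Sum.getLeft?_eq_some_iff] at hx'
    have := he (Sum.inl x)
    rw [hx'] at this
    exact this

/-- If the product of an `S × N` and an `N × S` matrix is unitriangular with respect to a
preorder, then `N` is at least as large as `S`. -/
theorem card_le_card_of_unitriangular {k : Type u} [Field k] {S : Type*} {N : Type*} [Fintype S]
    [Fintype N] {Γ : Type*} [LinearOrder Γ] (s : S → Γ) (a : S → N → k) (b : N → S → k)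
    (h1 : ∀ x, ∑ y, a x y * b y x = 1)
    (h0 : ∀ x x', x ≠ x' → s x ≤ s x' → ∑ y, a x y * b y x' = 0) :
    Fintype.card S ≤ Fintype.card N := by
  classical
  have hinj : Function.Injective (Matrix.vecMulLinear (Matrix.of a)) := by
    rw [← LinearMap.ker_eq_bot, LinearMap.ker_eq_bot']
    intro v hv
    by_contra hne
    have hsupp : (Finset.univ.filter fun x => v x ≠ 0).Nonempty := by
      obtain ⟨x, hx⟩ := Function.ne_iff.1 hne
      exact ⟨x, by simpa using hx⟩
    -- At an element of the support of `v` with maximal score, unitriangularity leaves only the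
    -- diagonal term of `v * a * b`, so that entry is `v x'`; but `v * a = 0`.
    obtain ⟨x', hx', hmax⟩ := Finset.exists_max_image _ s hsupp
    have hcol : ∀ y, ∑ x, v x * a x y = 0 := fun y => by
      have := congrFun hv y
      simpa [Matrix.vecMulLinear, Matrix.vecMul, dotProduct] using this
    have : v x' = 0 := by
      calc v x' = ∑ x, v x * ∑ y, a x y * b y x' := by
            rw [Finset.sum_eq_single x']
            · rw [h1, mul_one]
            · intro x _ hxx
              by_cases hvx : v x = 0
              · rw [hvx, zero_mul]
              · rw [h0 x x' hxx (hmax x (by simpa using hvx)), mul_zero]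
            · simp
        _ = ∑ y, (∑ x, v x * a x y) * b y x' := by
            simp_rw [Finset.mul_sum, Finset.sum_mul]
            rw [Finset.sum_comm]
            simp_rw [mul_assoc]
        _ = 0 := by simp [hcol]
    exact (by simpa using hx' : v x' ≠ 0) this
  simpa using LinearMap.finrank_le_finrank_of_injective hinj

/-! ### Cuts of the real line -/

/-- The lexicographic group in which the cuts of the real line are measured. -/
abbrev CutGroup := ℤ ×ₗ (ℝ ×ₗ ℤ)

/-- The translation by `δ`, as an element of the group of cuts. -/
def cutShift (δ : ℝ) : CutGroup := toLex (0, toLex (δ, 0))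

open Classical in
/-- The position of the upper end of a lower set of the real line. -/
def cut (D : Set ℝ) : CutGroup :=
  if D = ∅ then toLex (-1, toLex (0, 0)) else if D = Set.univ then toLex (1, toLex (0, 0)) else
    toLex (0, toLex (sSup D, if sSup D ∈ D then 1 else 0))

theorem cut_empty : cut ∅ = toLex (-1, toLex (0, 0)) := by simp [cut]

theorem cut_univ : cut Set.univ = toLex (1, toLex (0, 0)) := by
  simp [cut]

open Classical in
theorem cut_of_ne {D : Set ℝ} (h : D ≠ ∅) (h' : D ≠ Set.univ) :
    cut D = toLex (0, toLex (sSup D, if sSup D ∈ D then 1 else 0)) := by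
  simp [cut, h, h']

theorem toLex_add_cutShift (n : ℤ) (r : ℝ) (m : ℤ) (δ : ℝ) :
    (toLex (n, toLex (r, m)) + cutShift δ : CutGroup) = toLex (n, toLex (r + δ, m)) := by
  have : (toLex (n, toLex (r, m)) + cutShift δ : CutGroup) =
    toLex (n + 0, toLex (r + δ, m + 0)) := rfl
  rw [this, add_zero, add_zero]

theorem bddAbove_of_isLowerSet {D : Set ℝ} (hD : IsLowerSet D) {t : ℝ} (ht : t ∉ D) :
    ∀ d ∈ D, d < t := fun _ hd => lt_of_not_ge fun h => ht (hD h hd)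

/-- The last coordinate decides the tie `sSup D' + δ = sSup D`: the suprema are then `t - δ` and
`t`, of which only the second is attained. The outer coordinate separates the empty set and the
whole line while keeping cuts in an ordered group, where inequalities can be added and cancelled. -/
theorem cut_add_lt {D D' : Set ℝ} (hD : IsLowerSet D) (hD' : IsLowerSet D') {δ t : ℝ}
    (ht : t ∈ D) (ht' : t - δ ∉ D') : cut D' + cutShift δ < cut D := by
  have hne : D ≠ ∅ := fun h => by simp [h] at ht
  have hne' : D' ≠ Set.univ := fun h => by simp [h] at ht'
  by_cases h1 : D' = ∅
  · rw [h1, cut_empty, toLex_add_cutShift]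
    by_cases h2 : D = Set.univ
    · rw [h2, cut_univ, Prod.Lex.toLex_lt_toLex]; left; norm_num
    · rw [cut_of_ne hne h2, Prod.Lex.toLex_lt_toLex]; left; norm_num
  rw [cut_of_ne h1 hne', toLex_add_cutShift]
  by_cases h2 : D = Set.univ
  · rw [h2, cut_univ, Prod.Lex.toLex_lt_toLex]; left; norm_num
  rw [cut_of_ne hne h2, Prod.Lex.toLex_lt_toLex]
  right
  refine ⟨rfl, ?_⟩
  rw [Prod.Lex.toLex_lt_toLex]
  obtain ⟨t₀, ht₀⟩ := (Set.ne_univ_iff_exists_notMem _).1 h2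
  have hbdd : BddAbove D := ⟨t₀, fun d hd => (bddAbove_of_isLowerSet hD ht₀ d hd).le⟩
  have hle : t ≤ sSup D := le_csSup hbdd ht
  have hle' : sSup D' ≤ t - δ := csSup_le (Set.nonempty_iff_ne_empty.2 h1)
    fun d hd => (bddAbove_of_isLowerSet hD' ht' d hd).le
  rcases lt_or_eq_of_le (show sSup D' + δ ≤ sSup D by linarith) with h | h
  · exact Or.inl h
  · refine Or.inr ⟨h, ?_⟩
    have e1 : sSup D = t := by linarith
    have e2 : sSup D' = t - δ := by linarith
    simp only [e1, e2, ht, ht']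
    norm_num

/-- In a tie, a supremum attained in `D'` is moved by `-δ` to one attained in `D`. The sign of `δ`
matters only when both sets are empty or both are the whole line, since translation does not fix
these two cuts in the group. -/
theorem cut_le_add {D D' : Set ℝ} (hD : IsLowerSet D) {δ : ℝ}
    (hδ : 0 ≤ δ) (h : ∀ t ∈ D', t - δ ∈ D) : cut D' ≤ cut D + cutShift δ := by
  have hpos : (0 : CutGroup) ≤ cutShift δ := by
    change toLex (0, toLex (0, 0)) ≤ (toLex (0, toLex (δ, 0)) : CutGroup)
    simp only [Prod.Lex.toLex_le_toLex]
    exact Or.inr ⟨trivial, hδ.lt_or_eq.imp id fun h => ⟨h, le_rfl⟩⟩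
  by_cases h2 : D = ∅
  · have h1 : D' = ∅ := by
      rw [Set.eq_empty_iff_forall_notMem] at h2 ⊢
      exact fun t ht => h2 _ (h t ht)
    rw [h1, h2]
    exact le_add_of_nonneg_right hpos
  by_cases h3 : D' = Set.univ
  · have h1 : D = Set.univ := Set.eq_univ_of_forall fun t => by
      simpa using h (t + δ) (h3 ▸ Set.mem_univ _)
    rw [h1, h3]
    exact le_add_of_nonneg_right hpos
  by_cases h1 : D' = ∅
  · rw [h1, cut_empty]
    by_cases h4 : D = Set.univ
    · rw [h4, cut_univ, toLex_add_cutShift, Prod.Lex.toLex_le_toLex]; left; norm_num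
    · rw [cut_of_ne h2 h4, toLex_add_cutShift, Prod.Lex.toLex_le_toLex]; left; norm_num
  rw [cut_of_ne h1 h3]
  by_cases h4 : D = Set.univ
  · rw [h4, cut_univ, toLex_add_cutShift, Prod.Lex.toLex_le_toLex]; left; norm_num
  rw [cut_of_ne h2 h4, toLex_add_cutShift, Prod.Lex.toLex_le_toLex]
  refine Or.inr ⟨rfl, ?_⟩
  rw [Prod.Lex.toLex_le_toLex]
  obtain ⟨t₀, ht₀⟩ := (Set.ne_univ_iff_exists_notMem _).1 h4
  have hbdd : BddAbove D := ⟨t₀, fun d hd => (bddAbove_of_isLowerSet hD ht₀ d hd).le⟩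
  have hle : sSup D' ≤ sSup D + δ := csSup_le (Set.nonempty_iff_ne_empty.2 h1) fun d hd => by
    linarith [le_csSup hbdd (h d hd)]
  rcases hle.lt_or_eq with h5 | h5
  · exact Or.inl h5
  · refine Or.inr ⟨h5, ?_⟩
    by_cases h6 : sSup D' ∈ D'
    · have : sSup D ∈ D := by simpa [h5] using h _ h6
      simp [this]
      split_ifs <;> norm_num
    · simp only [h6, if_false]
      split_ifs <;> norm_num

/-! ### Structure maps and morphisms, as linear maps -/

section Transition

variable {k : Type u} [Field k] {P : Type v} [PartialOrder P]

/-- The structure map of a persistence module, as a linear map. -/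
def tr (V : PersMod k P) {p q : P} (h : p ≤ q) : V.obj p →ₗ[k] V.obj q :=
  (V.map (homOfLE h)).hom

theorem tr_refl (V : PersMod k P) {p : P} (h : p ≤ p) (v : V.obj p) : tr V h v = v := by
  have : V.map (homOfLE h) = 𝟙 _ := V.map_id p
  simp [tr]

theorem tr_tr (V : PersMod k P) {p q r : P} (h : p ≤ q) (h' : q ≤ r) (v : V.obj p) :
    tr V h' (tr V h v) = tr V (h.trans h') v := by
  have : V.map (homOfLE (h.trans h')) = V.map (homOfLE h) ≫ V.map (homOfLE h') := by
    rw [← V.map_comp]; rfl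
  simp [tr, this]

theorem app_tr {V W : PersMod k P} (f : V ⟶ W) {p q : P} (h : p ≤ q) (v : V.obj p) :
    (f.app q).hom (tr V h v) = tr W h ((f.app p).hom v) := by
  have := f.naturality (homOfLE h)
  exact congrArg (fun g => g.hom v) this

theorem tr_shiftModule (Λ : PosetAction P) (ε : ℝ≥0) (V : PersMod k P) {p q : P} (h : p ≤ q)
    (v : (shiftModule Λ ε V).obj p) :
    tr (shiftModule Λ ε V) h v =
      (tr V ((Λ.shift ε).monotone h) : V.obj (Λ.shift ε p) →ₗ[k] V.obj (Λ.shift ε q)) v := rfl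

/-- A morphism of persistence modules from pointwise linear maps. -/
def homMk {V W : PersMod k P} (f : ∀ p, V.obj p →ₗ[k] W.obj p)
    (hf : ∀ {p q} (h : p ≤ q) (v : V.obj p), f q (tr V h v) = tr W h (f p v)) : V ⟶ W where
  app p := ModuleCat.ofHom (f p)
  naturality p q g := by
    ext v
    exact hf (leOfHom g) v

/-- The inclusion of the spaces of an interval module into `k`. -/
def ival (I : PosetInterval P) (p : P) : (intervalModule k I).obj p →ₗ[k] k :=
  (intervalSpace k I p).subtype

theorem ival_injective (I : PosetInterval P) (p : P) :
    Function.Injective (ival (k := k) I p) :=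
  Subtype.val_injective

theorem ival_eq_zero (I : PosetInterval P) {p : P} (hp : p ∉ I.carrier)
    (x : (intervalModule k I).obj p) : ival I p x = 0 :=
  intervalSpace_mem.1 (Subtype.property (p := fun y => y ∈ intervalSpace k I p) x) hp

open Classical in
theorem ival_tr (I : PosetInterval P) {p q : P} (h : p ≤ q) (x : (intervalModule k I).obj p) :
    ival I q (tr _ h x) = if p ∈ I.carrier ∧ q ∈ I.carrier then ival I p x else 0 :=
  intervalMap_val k I p q x

/-- A map to `k` which vanishes outside of the interval, as a map to the interval module. -/
def icod {I : PosetInterval P} {p : P} {X : Type*} [AddCommGroup X] [Module k X] (f : X →ₗ[k] k)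
    (hf : p ∉ I.carrier → f = 0) : X →ₗ[k] (intervalModule k I).obj p :=
  f.codRestrict (intervalSpace k I p) fun v => intervalSpace_mem.2 fun hp => by
    rw [hf hp, LinearMap.zero_apply]

theorem ival_icod {I : PosetInterval P} {p : P} {X : Type*} [AddCommGroup X] [Module k X]
    (f : X →ₗ[k] k) (hf : p ∉ I.carrier → f = 0) (x : X) : ival I p (icod f hf x) = f x := rfl

open Classical in
variable (k) in
/-- The generator of an interval module. -/
def ione (I : PosetInterval P) (p : P) : (intervalModule k I).obj p :=
  (⟨if p ∈ I.carrier then 1 else 0, intervalSpace_mem.2 fun h => by simp [h]⟩ :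
    intervalSpace k I p)

open Classical in
theorem ival_ione (I : PosetInterval P) (p : P) :
    ival I p (ione k I p) = if p ∈ I.carrier then 1 else 0 := rfl

end Transition

/-! ### Direct sums -/

section DirectSums

variable {k : Type u} [Field k] {P : Type v} [PartialOrder P] {V : PersMod k P} {ι : Type w}
  {M : ι → PersMod k P}

open Classical in
/-- Morphisms out of a direct sum are determined by their restrictions to the summands. -/
theorem IsDirectSum.exists_desc (h : IsDirectSum V M) :
    ∃ inj : ∀ i, M i ⟶ V,
      (∀ p, Function.Bijective (DirectSum.toModule k ι (V.obj p) fun i => ((inj i).app p).hom :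
        (DirectSum ι fun i => (M i).obj p) →ₗ[k] V.obj p)) ∧
      (∀ (X : PersMod k P) (g : ∀ i, M i ⟶ X), ∃ f : V ⟶ X, ∀ i, inj i ≫ f = g i) ∧
      (∀ (X : PersMod k P) (f f' : V ⟶ X), (∀ i, inj i ≫ f = inj i ≫ f') → f = f') := by
  obtain ⟨inj, hinj⟩ := h
  let E (p : P) := LinearEquiv.ofBijective _ (hinj p)
  have hE : ∀ p i (x : (M i).obj p), (E p).symm (((inj i).app p).hom x) =
      DirectSum.lof k ι (fun i => (M i).obj p) i x := by
    intro p i x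
    rw [LinearEquiv.symm_apply_eq]
    simp [E, DirectSum.toModule_lof]
  have hind : ∀ p (Q : V.obj p → Prop) (_zero : Q 0) (_of : ∀ i x, Q (((inj i).app p).hom x))
      (_add : ∀ v v', Q v → Q v' → Q (v + v')) (v : V.obj p), Q v := by
    intro p Q h0 hi ha v
    obtain ⟨d, rfl⟩ := (hinj p).2 v
    induction d using DirectSum.induction_on with
    | zero => simpa using h0
    | of i x =>
      have := hi i x
      have h2 := DirectSum.toModule_lof (R := k) (φ := fun i => ((inj i).app p).hom) i x
      rw [← h2] at this
      exact this
    | add d d' hd hd' => rw [map_add]; exact ha _ _ hd hd'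
  refine ⟨inj, hinj, ?_, ?_⟩
  · intro X g
    refine ⟨homMk (fun p => (DirectSum.toModule k ι (X.obj p) fun i => ((g i).app p).hom) ∘ₗ
      (E p).symm.toLinearMap) ?_, ?_⟩
    · intro p q hpq v
      induction v using hind p with
      | _zero => simp
      | _of i x =>
        simp only [LinearMap.comp_apply, LinearEquiv.coe_coe]
        rw [hE, ← app_tr, hE, DirectSum.toModule_lof, DirectSum.toModule_lof, app_tr]
      | _add v v' hv hv' => simp only [map_add, hv, hv']
    · intro i
      ext p x
      change (DirectSum.toModule k ι (X.obj p) fun i => ((g i).app p).hom)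
        ((E p).symm (((inj i).app p).hom x)) = ((g i).app p).hom x
      rw [hE, DirectSum.toModule_lof]
  · intro X f f' hff
    ext p v
    induction v using hind p with
    | _zero => simp
    | _of i x => exact congrArg (fun g => (g.app p).hom x) (hff i)
    | _add v v' hv hv' => simp only [map_add, hv, hv']

end DirectSums

/-! ### Interval summands -/

section Summands

variable {k : Type u} [Field k] {P : Type v} [PartialOrder P]

/-- A summand of `V` isomorphic to an interval module: a compatible family of vectors `e` supported
on the interval, spanning a copy of the interval module, and a compatible family of functionals
`ξ`, which is the projection onto it. -/
structure IntervalSummand (V : PersMod k P) where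
  I : PosetInterval P
  e : ∀ p, V.obj p
  ξ : ∀ p, V.obj p →ₗ[k] k
  e_eq_zero : ∀ p, p ∉ I.carrier → e p = 0
  tr_e : ∀ {p q} (h : p ≤ q), p ∈ I.carrier → tr V h (e p) = e q
  ξ_eq_zero : ∀ p, p ∉ I.carrier → ξ p = 0
  ξ_tr : ∀ {p q} (h : p ≤ q), q ∈ I.carrier → ∀ v, ξ q (tr V h v) = ξ p v
  ξ_e : ∀ p, p ∈ I.carrier → ξ p (e p) = 1

/-- The maps `v ↦ ξ v • e` thus form an endomorphism of `V`, the idempotent of the summand. -/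
theorem IntervalSummand.tr_smul {V : PersMod k P} (s : IntervalSummand V) {p q : P} (h : p ≤ q)
    (v : V.obj p) : tr V h (s.ξ p v • s.e p) = s.ξ q (tr V h v) • s.e q := by
  by_cases hp : p ∈ s.I.carrier
  · rw [map_smul, s.tr_e h hp]
    by_cases hq : q ∈ s.I.carrier
    · rw [s.ξ_tr h hq]
    · rw [s.e_eq_zero q hq, smul_zero, smul_zero]
  · rw [s.e_eq_zero p hp, smul_zero, map_zero]
    by_cases hq : q ∈ s.I.carrier
    · rw [s.ξ_tr h hq, s.ξ_eq_zero p hp, LinearMap.zero_apply, zero_smul]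
    · rw [s.e_eq_zero q hq, smul_zero]

/-- The inclusion of the interval module. -/
def IntervalSummand.incl {V : PersMod k P} (s : IntervalSummand V) : intervalModule k s.I ⟶ V :=
  homMk (fun p => (LinearMap.toSpanSingleton k (V.obj p) (s.e p)) ∘ₗ ival s.I p)
    fun {p q} h x => by
    simp only [LinearMap.comp_apply, LinearMap.toSpanSingleton_apply, ival_tr, map_smul]
    by_cases hp : p ∈ s.I.carrier
    · rw [s.tr_e h hp]
      by_cases hq : q ∈ s.I.carrier
      · simp [hp, hq]
      · simp [s.e_eq_zero q hq]
    · simp [hp, s.e_eq_zero p hp]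

theorem IntervalSummand.incl_app {V : PersMod k P} (s : IntervalSummand V) (p : P)
    (x : (intervalModule k s.I).obj p) : (s.incl.app p).hom x = ival s.I p x • s.e p := rfl

/-- The projection to the interval module. -/
def IntervalSummand.proj {V : PersMod k P} (s : IntervalSummand V) : V ⟶ intervalModule k s.I :=
  homMk (fun p => icod (s.ξ p) (s.ξ_eq_zero p)) fun {p q} h v => by
    apply ival_injective
    rw [ival_tr, ival_icod, ival_icod]
    by_cases hq : q ∈ s.I.carrier
    · rw [s.ξ_tr h hq]
      by_cases hp : p ∈ s.I.carrier
      · simp [hp, hq]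
      · simp [hp, s.ξ_eq_zero p hp]
    · simp [hq, s.ξ_eq_zero q hq]

theorem IntervalSummand.incl_proj {V : PersMod k P} (s : IntervalSummand V) :
    s.incl ≫ s.proj = 𝟙 _ := by
  ext p x
  apply ival_injective
  change s.ξ p (ival s.I p x • s.e p) = ival s.I p x
  by_cases hp : p ∈ s.I.carrier
  · rw [map_smul, s.ξ_e p hp, smul_eq_mul, mul_one]
  · rw [ival_eq_zero _ hp, zero_smul, map_zero]

/-- A family of interval summands is orthogonal if the projection to each of them kills all the
other ones. -/
def Orthogonal {V : PersMod k P} {ι : Type w} (s : ι → IntervalSummand V) : Prop :=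
  ∀ i j, i ≠ j → ∀ p, (s i).ξ p ((s j).e p) = 0

/-- An orthogonal family of interval summands is a basis if the projections are jointly
injective. -/
def IsIntervalBasis {V : PersMod k P} {ι : Type w} (s : ι → IntervalSummand V) : Prop :=
  Orthogonal s ∧ ∀ p v, (∀ i, (s i).ξ p v = 0) → v = 0

/-- At `p` the functionals are dual to the vectors of the summands alive there, so these vectors are
linearly independent in a finite-dimensional space. -/
theorem Orthogonal.finite {V : PersMod k P} (hV : IsPfd V) {ι : Type w}
    {s : ι → IntervalSummand V} (hs : Orthogonal s) (p : P) :
    {i | p ∈ (s i).I.carrier}.Finite := by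
  classical
  have := hV p
  have hli : LinearIndependent k fun i : {i | p ∈ (s i).I.carrier} => (s i).e p := by
    rw [linearIndependent_iff']
    intro t g hg i hi
    have := congrArg ((s i).ξ p) hg
    rw [map_sum, map_zero, Finset.sum_eq_single i] at this
    · simpa [(s i).ξ_e p i.2] using this
    · intro j _ hj
      rw [map_smul, hs i j (fun h => hj (Subtype.ext h.symm)), smul_zero]
    · exact fun h => absurd hi h
  exact hli.finite

theorem IsIntervalBasis.eq_sum {V : PersMod k P} {ι : Type w} {s : ι → IntervalSummand V}
    (hs : IsIntervalBasis s) {p : P} (t : Finset ι) (ht : ∀ i, p ∈ (s i).I.carrier → i ∈ t)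
    (v : V.obj p) : v = ∑ i ∈ t, (s i).ξ p v • (s i).e p := by
  rw [← sub_eq_zero]
  refine hs.2 p _ fun i => ?_
  by_cases hi : p ∈ (s i).I.carrier
  · rw [map_sub, map_sum, Finset.sum_eq_single i]
    · simp [(s i).ξ_e p hi]
    · intro j _ hj
      rw [map_smul, hs.1 i j hj.symm, smul_zero]
    · exact fun h => absurd (ht i hi) h
  · rw [(s i).ξ_eq_zero p hi, LinearMap.zero_apply]

theorem IsIntervalBasis.isDirectSum {V : PersMod k P} (hV : IsPfd V) {ι : Type w}
    {s : ι → IntervalSummand V} (hs : IsIntervalBasis s) :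
    IsDirectSum V fun i => intervalModule k (s i).I := by
  classical
  refine ⟨fun i => (s i).incl, fun p => ⟨?_, ?_⟩⟩
  · rw [← LinearMap.ker_eq_bot, LinearMap.ker_eq_bot']
    intro d hd
    have key : ∀ (d : DirectSum ι fun i => (intervalModule k (s i).I).obj p) i,
        (s i).ξ p (DirectSum.toModule k ι (V.obj p) (fun i => ((s i).incl.app p).hom) d) =
          ival (s i).I p (d i) := by
      intro d i
      induction d using DirectSum.induction_on with
      | zero => simp
      | of j x =>
        have h2 := DirectSum.toModule_lof (R := k) (φ := fun i => ((s i).incl.app p).hom) j x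
        refine (congrArg _ h2).trans ?_
        rw [IntervalSummand.incl_app, map_smul]
        by_cases hij : i = j
        · subst hij
          rw [DirectSum.of_eq_same]
          by_cases hp : p ∈ (s i).I.carrier
          · rw [(s i).ξ_e p hp, smul_eq_mul, mul_one]
          · rw [ival_eq_zero _ hp, zero_smul]
        · rw [hs.1 i j hij, DirectSum.of_eq_of_ne _ _ _ hij, smul_zero, map_zero]
      | add d d' hd hd' => rw [map_add, map_add, hd, hd', DirectSum.add_apply, map_add]
    ext i
    apply ival_injective
    rw [← key, hd, map_zero]
    exact (map_zero _).symm
  · intro v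
    have hfin := hs.1.finite hV p
    refine ⟨∑ i ∈ hfin.toFinset, DirectSum.lof k ι (fun i => (intervalModule k (s i).I).obj p) i
      (((s i).proj.app p).hom v), ?_⟩
    rw [map_sum]
    simp_rw [DirectSum.toModule_lof]
    exact (hs.eq_sum hfin.toFinset (fun i hi => by simpa using hi) v).symm

open Classical in
/-- A direct sum of interval modules has an interval basis. -/
theorem IsDirectSum.exists_isIntervalBasis {V : PersMod k P} {ι : Type w} {I : ι → PosetInterval P}
    (h : IsDirectSum V fun i => intervalModule k (I i)) :
    ∃ s : ι → IntervalSummand V, (∀ i, (s i).I = I i) ∧ IsIntervalBasis s := by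
  obtain ⟨inj, hbij, hdesc, -⟩ := h.exists_desc
  choose π hπ using fun i => hdesc (intervalModule k (I i)) fun j =>
    if h : j = i then eqToHom (by rw [h]) else 0
  have hsame : ∀ i p (x : (intervalModule k (I i)).obj p),
      ((π i).app p).hom (((inj i).app p).hom x) = x := by
    intro i p x
    have h2 : inj i ≫ π i = 𝟙 _ := by simpa using hπ i i
    exact congrArg (fun f => (f.app p).hom x) h2
  have hne : ∀ i j p (x : (intervalModule k (I j)).obj p), j ≠ i →
      ((π i).app p).hom (((inj j).app p).hom x) = 0 := by
    intro i j p x hij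
    have h2 : inj j ≫ π i = 0 := by simpa [hij] using hπ i j
    exact congrArg (fun f => (f.app p).hom x) h2
  let s : ι → IntervalSummand V := fun i =>
    { I := I i
      e := fun p => ((inj i).app p).hom (ione k (I i) p)
      ξ := fun p => ival (I i) p ∘ₗ ((π i).app p).hom
      e_eq_zero := fun p hp => by
        have : ione k (I i) p = 0 := ival_injective _ _ (by simp [ival_ione, hp])
        rw [this, map_zero]
      tr_e := fun {p q} h hp => by
        rw [← app_tr]
        congr 1
        apply ival_injective
        by_cases hq : q ∈ (I i).carrier <;> simp [ival_tr, ival_ione, hp, hq]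
      ξ_eq_zero := fun p hp => LinearMap.ext fun v => ival_eq_zero _ hp _
      ξ_tr := fun {p q} h hq v => by
        simp only [LinearMap.comp_apply]
        rw [app_tr, ival_tr]
        by_cases hp : p ∈ (I i).carrier
        · simp [hp, hq]
        · simp [hp, ival_eq_zero]
      ξ_e := fun p hp => by simp [hsame, ival_ione, hp] }
  refine ⟨s, fun i => rfl, ?_, ?_⟩
  · intro i j hij p
    simp [s, hne i j p _ hij.symm]
  · intro p v hv
    obtain ⟨d, rfl⟩ := (hbij p).2 v
    have key : ∀ (d : DirectSum ι fun i => (intervalModule k (I i)).obj p) i,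
        ((π i).app p).hom (DirectSum.toModule k ι (V.obj p) (fun i => ((inj i).app p).hom) d) =
          d i := by
      intro d i
      induction d using DirectSum.induction_on with
      | zero => simp
      | of j x =>
        have h2 := DirectSum.toModule_lof (R := k) (φ := fun i => ((inj i).app p).hom) j x
        refine (congrArg _ h2).trans ?_
        by_cases hij : j = i
        · subst hij
          rw [DirectSum.of_eq_same, hsame]
        · rw [hne i j p x hij, DirectSum.of_eq_of_ne _ _ _ (Ne.symm hij)]
      | add d d' hd hd' => rw [map_add, map_add, hd, hd']; rfl
    have : d = 0 := by
      ext i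
      rw [← key]
      exact ival_injective _ _ ((hv i).trans (map_zero _).symm)
    rw [this, map_zero]

end Summands

/-! ### Linear algebra for splitting off interval summands -/

section LinearAlgebra

variable {k : Type u} [Field k]

/-- A functional on `U` extends along a directed system under `U` if it vanishes on the kernels
of all the maps from `U` to the system. -/
theorem exists_extension_directedSystem {ι : Type*} [Preorder ι] [Nonempty ι] [IsDirectedOrder ι]
    {G : ι → Type*} [∀ i, AddCommGroup (G i)] [∀ i, Module k (G i)]
    (f : ∀ i j, i ≤ j → G i →ₗ[k] G j) [DirectedSystem G fun i j h => f i j h]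
    {U : Type*} [AddCommGroup U] [Module k U] (g : ∀ i, U →ₗ[k] G i)
    (hg : ∀ i j h x, f i j h (g i x) = g j x) (ξ : U →ₗ[k] k)
    (hξ : ∀ i x, g i x = 0 → ξ x = 0) :
    ∃ η : ∀ i, G i →ₗ[k] k, (∀ i j h x, η j (f i j h x) = η i x) ∧ ∀ i x, η i (g i x) = ξ x := by
  classical
  obtain ⟨i₀⟩ := ‹Nonempty ι›
  let Φ : U →ₗ[k] Module.DirectLimit G f := Module.DirectLimit.of k ι G f i₀ ∘ₗ g i₀
  have hΦ : ∀ i x, Module.DirectLimit.of k ι G f i (g i x) = Φ x := by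
    intro i x
    obtain ⟨j, hij, h0j⟩ := exists_ge_ge i i₀
    simp only [Φ, LinearMap.comp_apply]
    rw [← Module.DirectLimit.of_f (hij := hij), ← Module.DirectLimit.of_f (hij := h0j), hg, hg]
  -- An element of `U` dies in the direct limit only if some `g j` already kills it. So `ξ` vanishes
  -- on the kernel of `Φ` and factors through the limit.
  have hmem : ξ ∈ (LinearMap.ker Φ).dualAnnihilator := by
    rw [Submodule.mem_dualAnnihilator]
    intro x hx
    obtain ⟨j, hj, h⟩ := Module.DirectLimit.of.zero_exact (LinearMap.mem_ker.1 hx)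
    rw [hg] at h
    exact hξ j x h
  rw [← LinearMap.range_dualMap_eq_dualAnnihilator_ker] at hmem
  obtain ⟨ψ, hψ⟩ := hmem
  refine ⟨fun i => ψ ∘ₗ Module.DirectLimit.of k ι G f i, ?_, ?_⟩
  · intro i j h x
    simp only [LinearMap.comp_apply, Module.DirectLimit.of_f]
  · intro i x
    simp only [LinearMap.comp_apply, hΦ, ← hψ]
    rfl

variable {U : Type*} [AddCommGroup U] [Module k U] [Module.Finite k U]

theorem exists_greatest_of_isChain {C : Set (Submodule k U)} (hC : IsChain (· ≤ ·) C)
    (hne : C.Nonempty) : ∃ K ∈ C, ∀ L ∈ C, L ≤ K := by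
  obtain ⟨K, hK, hmax⟩ := (wellFounded_gt (α := Submodule k U)).has_min C hne
  refine ⟨K, hK, fun L hL => ?_⟩
  rcases hC.total hL hK with h | h
  · exact h
  · exact (eq_of_le_of_not_lt h (hmax L hL)).ge

theorem exists_least_of_isChain {C : Set (Submodule k U)} (hC : IsChain (· ≤ ·) C)
    (hne : C.Nonempty) : ∃ K ∈ C, ∀ L ∈ C, K ≤ L := by
  obtain ⟨K, hK, hmin⟩ := (wellFounded_lt (α := Submodule k U)).has_min C hne
  refine ⟨K, hK, fun L hL => ?_⟩
  rcases hC.total hL hK with h | h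
  · exact (eq_of_le_of_not_lt h (hmin L hL)).ge
  · exact h

/-- A vector and a functional which are compatible with two chains of subspaces. -/
theorem exists_vector_functional [Nontrivial U] {C C' : Set (Submodule k U)}
    (hC : IsChain (· ≤ ·) C) (hC' : IsChain (· ≤ ·) C') :
    ∃ (e : U) (ξ : U →ₗ[k] k), ξ e = 1 ∧ ∀ K, K ∈ C ∨ K ∈ C' → e ∈ K ∨ ∀ x ∈ K, ξ x = 0 := by
  -- `A` is the largest proper member of `C`. The members of `C'` split into those spanning `U`
  -- together with `A`, with least member `Q`, and the others, with largest member `B`. A nonzero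
  -- functional killing `A` and `B` cannot kill `Q`, and a vector of `Q` is taken for `e`. The
  -- defaults are `⊥`, `⊥` and `⊤` when there is no such member.
  obtain ⟨A, hA, hA'⟩ : ∃ A : Submodule k U, A ≠ ⊤ ∧ ∀ K ∈ C, K = ⊤ ∨ K ≤ A := by
    by_cases hne : {K ∈ C | K ≠ ⊤}.Nonempty
    · obtain ⟨K, hK, h⟩ := exists_greatest_of_isChain (hC.mono (Set.sep_subset _ _)) hne
      exact ⟨K, hK.2, fun L hL => or_iff_not_imp_left.2 fun h' => h L ⟨hL, h'⟩⟩
    · refine ⟨⊥, bot_ne_top, fun K hK => Or.inl ?_⟩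
      by_contra h
      exact hne ⟨K, hK, h⟩
  obtain ⟨B, hB, hB'⟩ : ∃ B : Submodule k U, B ⊔ A ≠ ⊤ ∧ ∀ K ∈ C', K ⊔ A = ⊤ ∨ K ≤ B := by
    by_cases hne : {K ∈ C' | K ⊔ A ≠ ⊤}.Nonempty
    · obtain ⟨K, hK, h⟩ := exists_greatest_of_isChain (hC'.mono (Set.sep_subset _ _)) hne
      exact ⟨K, hK.2, fun L hL => or_iff_not_imp_left.2 fun h' => h L ⟨hL, h'⟩⟩
    · refine ⟨⊥, by rwa [bot_sup_eq], fun K hK => Or.inl ?_⟩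
      by_contra h
      exact hne ⟨K, hK, h⟩
  obtain ⟨Q, hQ, hQ'⟩ : ∃ Q : Submodule k U, Q ⊔ A = ⊤ ∧ ∀ K ∈ C', K ⊔ A = ⊤ → Q ≤ K := by
    by_cases hne : {K ∈ C' | K ⊔ A = ⊤}.Nonempty
    · obtain ⟨K, hK, h⟩ := exists_least_of_isChain (hC'.mono (Set.sep_subset _ _)) hne
      exact ⟨K, hK.2, fun L hL h' => h L ⟨hL, h'⟩⟩
    · exact ⟨⊤, top_sup_eq _, fun K hK h => absurd ⟨K, hK, h⟩ hne⟩
  obtain ⟨ξ, hξ, hle⟩ := Submodule.exists_le_ker_of_lt_top _ (lt_top_iff_ne_top.2 hB)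
  obtain ⟨x, hx, hξx⟩ : ∃ x ∈ Q, ξ x ≠ 0 := by
    by_contra! h
    apply hξ
    rw [← LinearMap.ker_eq_top, ← top_le_iff, ← hQ]
    exact sup_le (fun x hx => LinearMap.mem_ker.2 (h x hx)) (le_sup_right.trans hle)
  refine ⟨(ξ x)⁻¹ • x, ξ, by simp [hξx], ?_⟩
  rintro K (hK | hK)
  · rcases hA' K hK with h | h
    · left; rw [h]; trivial
    · exact Or.inr fun y hy => LinearMap.mem_ker.1 (hle (le_sup_right (a := B) (h hy)))
  · rcases hB' K hK with h | h
    · exact Or.inl (K.smul_mem _ (hQ' K hK h hx))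
    · exact Or.inr fun y hy => LinearMap.mem_ker.1 (hle (le_sup_left (b := A) (h hy)))

end LinearAlgebra

section Extension

variable {k : Type u} [Field k] {P : Type v} [PartialOrder P]

/-- Extension of a functional at `b` along a directed set of points above `b`. -/
theorem exists_extension (V : PersMod k P) {b : P} {T : Set P} (hT : DirectedOn (· ≤ ·) T)
    (hne : T.Nonempty) (hb : ∀ p ∈ T, b ≤ p) (ξ : V.obj b →ₗ[k] k)
    (hξ : ∀ p (hp : p ∈ T) x, tr V (hb p hp) x = 0 → ξ x = 0) :
    ∃ η : ∀ p, V.obj p →ₗ[k] k,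
      (∀ {p q} (h : p ≤ q), p ∈ T → q ∈ T → ∀ v, η q (tr V h v) = η p v) ∧
      ∀ p (hp : p ∈ T) x, η p (tr V (hb p hp) x) = ξ x := by
  classical
  have : Nonempty T := hne.to_subtype
  have : IsDirectedOrder T := hT.isDirectedOrder
  let f : ∀ i j : T, i ≤ j → V.obj i →ₗ[k] V.obj j := fun i j h => tr V h
  have : DirectedSystem (fun i : T => V.obj i) fun i j h => f i j h :=
    ⟨fun i x => tr_refl V _ x, fun i j l h h' x => tr_tr V _ _ x⟩
  obtain ⟨η, h1, h2⟩ := exists_extension_directedSystem f (fun i : T => tr V (hb i i.2))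
    (fun i j h x => tr_tr V _ _ x) ξ (fun i x h => hξ i i.2 x h)
  refine ⟨fun p => if hp : p ∈ T then η ⟨p, hp⟩ else 0, ?_, ?_⟩
  · intro p q h hp hq v
    simpa only [dif_pos hp, dif_pos hq] using h1 ⟨p, hp⟩ ⟨q, hq⟩ h v
  · intro p hp x
    simpa only [dif_pos hp] using h2 ⟨p, hp⟩ x

/-- Lift of a vector at `b` along a codirected set of points below `b`. -/
theorem exists_lift (V : PersMod k P) (hV : IsPfd V) {b : P} {T : Set P}
    (hT : DirectedOn (· ≥ ·) T) (hne : T.Nonempty) (hb : ∀ p ∈ T, p ≤ b) (e : V.obj b)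
    (he : ∀ p (hp : p ∈ T), ∃ x, tr V (hb p hp) x = e) :
    ∃ c : ∀ p, V.obj p,
      (∀ {p q} (h : p ≤ q), p ∈ T → q ∈ T → tr V h (c p) = c q) ∧
      ∀ p (hp : p ∈ T), tr V (hb p hp) (c p) = e := by
  classical
  have hrefl : ∀ p, Module.IsReflexive k (V.obj p) := fun p => by
    have := hV p
    infer_instance
  have : Nonempty Tᵒᵈ := hne.to_subtype
  have : IsDirectedOrder Tᵒᵈ := ⟨fun a c => by
    obtain ⟨z, hz, h1, h2⟩ := hT (OrderDual.ofDual a).1 (OrderDual.ofDual a).2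
      (OrderDual.ofDual c).1 (OrderDual.ofDual c).2
    exact ⟨OrderDual.toDual ⟨z, hz⟩, h1, h2⟩⟩
  -- Dualizing turns the codirected system into a directed one and the lifting of `e` into the
  -- extension of the functional "evaluate at `e`". Reflexivity of finite-dimensional spaces turns
  -- the extension back into vectors.
  let f : ∀ i j : Tᵒᵈ, i ≤ j → Module.Dual k (V.obj (OrderDual.ofDual i).1) →ₗ[k]
    Module.Dual k (V.obj (OrderDual.ofDual j).1) := fun i j h =>
      (tr V (show (OrderDual.ofDual j).1 ≤ (OrderDual.ofDual i).1 from h)).dualMap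
  have : DirectedSystem (fun i : Tᵒᵈ => Module.Dual k (V.obj (OrderDual.ofDual i).1))
      fun i j h => f i j h :=
    ⟨fun i φ => LinearMap.ext fun x => congrArg φ (tr_refl V _ x),
      fun i j l h h' φ => LinearMap.ext fun x => congrArg φ (tr_tr V _ _ x)⟩
  obtain ⟨η, h1, h2⟩ := exists_extension_directedSystem f
    (fun i : Tᵒᵈ => (tr V (hb (OrderDual.ofDual i).1 (OrderDual.ofDual i).2)).dualMap)
    (fun i j h φ => LinearMap.ext fun x => congrArg φ (tr_tr V _ _ x))
    (Module.Dual.eval k (V.obj b) e) (fun i φ h => by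
      obtain ⟨x, hx⟩ := he (OrderDual.ofDual i).1 (OrderDual.ofDual i).2
      have := LinearMap.congr_fun h x
      rw [LinearMap.dualMap_apply, hx] at this
      exact this)
  let c : ∀ i : T, V.obj i := fun i =>
    (@Module.evalEquiv k (V.obj i) _ _ _ (hrefl i)).symm (η (OrderDual.toDual i))
  have hc : ∀ (i : T) (φ : Module.Dual k (V.obj i)), φ (c i) = η (OrderDual.toDual i) φ := by
    intro i φ
    have : Module.Dual.eval k (V.obj i) (c i) = η (OrderDual.toDual i) :=
      (@Module.evalEquiv k (V.obj i) _ _ _ (hrefl i)).apply_symm_apply _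
    rw [← this]
    rfl
  refine ⟨fun p => if hp : p ∈ T then c ⟨p, hp⟩ else 0, ?_, ?_⟩
  · intro p q h hp hq
    simp only [dif_pos hp, dif_pos hq]
    rw [← sub_eq_zero, ← Module.forall_dual_apply_eq_zero_iff k]
    intro φ
    rw [map_sub, sub_eq_zero]
    exact (hc ⟨p, hp⟩ (φ ∘ₗ tr V h)).trans
      ((h1 (OrderDual.toDual ⟨q, hq⟩) (OrderDual.toDual ⟨p, hp⟩) h φ).trans (hc ⟨q, hq⟩ φ).symm)
  · intro p hp
    simp only [dif_pos hp]
    rw [← sub_eq_zero, ← Module.forall_dual_apply_eq_zero_iff k]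
    intro φ
    rw [map_sub, sub_eq_zero]
    exact (hc ⟨p, hp⟩ (φ ∘ₗ tr V (hb p hp))).trans (h2 (OrderDual.toDual ⟨p, hp⟩) φ)

open Classical in
/-- An interval summand is assembled from a vector and a functional at a point `b`, an extension
of the functional to the points above `b` where the vector survives, and a lift of the vector
to the points below `b` where the functional survives. -/
theorem exists_intervalSummand_of_star (V : PersMod k P) (b : P) (e : V.obj b)
    (ξ : V.obj b →ₗ[k] k) (he : ξ e = 1) (U D : Set P)
    (hU : ∀ p, p ∈ U ↔ ∃ h : b ≤ p, tr V h e ≠ 0)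
    (hD : ∀ p, p ∈ D ↔ ∃ h : p ≤ b, ∃ x, ξ (tr V h x) ≠ 0)
    (hU' : ∀ p q, p ≤ q → q ∈ U → b ≤ p ∨ p ≤ b) (hD' : ∀ p q, p ≤ q → p ∈ D → b ≤ q ∨ q ≤ b)
    (η : ∀ p, V.obj p →ₗ[k] k)
    (hη : ∀ {p q} (h : p ≤ q), p ∈ U → q ∈ U → ∀ v, η q (tr V h v) = η p v)
    (hηb : ∀ p ∈ U, ∀ h : b ≤ p, ∀ v, η p (tr V h v) = ξ v)
    (c : ∀ p, V.obj p)
    (hc : ∀ {p q} (h : p ≤ q), p ∈ D → q ∈ D → tr V h (c p) = c q)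
    (hcb : ∀ p ∈ D, ∀ h : p ≤ b, tr V h (c p) = e) :
    Nonempty (IntervalSummand V) := by
  have he0 : e ≠ 0 := fun h => by simp [h] at he
  have hbU : b ∈ U := (hU b).2 ⟨le_rfl, by rwa [tr_refl]⟩
  have hbD : b ∈ D := (hD b).2 ⟨le_rfl, e, by simp [tr_refl, he]⟩
  have hUb : ∀ {p}, p ∈ U → b ≤ p := fun hp => ((hU _).1 hp).1
  have hDb : ∀ {p}, p ∈ D → p ≤ b := fun hp => ((hD _).1 hp).1
  have hUU : ∀ {p q}, b ≤ p → p ≤ q → q ∈ U → p ∈ U := by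
    intro p q hbp hpq hq
    obtain ⟨h, h'⟩ := (hU q).1 hq
    refine (hU p).2 ⟨hbp, fun h0 => h' ?_⟩
    rw [← tr_tr V hbp hpq, h0, map_zero]
  have hDD : ∀ {p q}, q ≤ b → p ≤ q → p ∈ D → q ∈ D := by
    intro p q hqb hpq hp
    obtain ⟨h, x, h'⟩ := (hD p).1 hp
    exact (hD q).2 ⟨hqb, tr V hpq x, by rwa [tr_tr]⟩
  have hηb' : ∀ v, η b v = ξ v := fun v => by simpa [tr_refl] using hηb b hbU le_rfl v
  have hcb' : c b = e := by simpa [tr_refl] using hcb b hbD le_rfl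
  have hUD : ∀ {p q}, p ≤ q → p ∈ U → q ∈ D → p = b ∧ q = b := fun hpq hp hq =>
    ⟨le_antisymm (hpq.trans (hDb hq)) (hUb hp), le_antisymm (hDb hq) ((hUb hp).trans hpq)⟩
  -- Above `b` the vector is pushed forward and below `b` it is lifted; the functional is pulled
  -- back below `b` and extended above. The two regions meet only in `b`, where the definitions
  -- agree.
  let E : ∀ p, V.obj p := fun p =>
    if h : p ∈ U then tr V (hUb h) e else if p ∈ D then c p else 0
  let Ξ : ∀ p, V.obj p →ₗ[k] k := fun p =>
    if h : p ∈ D then ξ ∘ₗ tr V (hDb h) else if p ∈ U then η p else 0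
  have hEU : ∀ p (h : b ≤ p), E p = tr V h e := by
    intro p h
    by_cases hp : p ∈ U
    · simp only [E, dif_pos hp]
    · have h0 : tr V h e = 0 := by
        by_contra h0
        exact hp ((hU p).2 ⟨h, h0⟩)
      have hpD : p ∉ D := fun hpD => hp (le_antisymm h (hDb hpD) ▸ hbU)
      simp only [E, dif_neg hp, if_neg hpD, h0]
  have hED : ∀ p ∈ D, E p = c p := by
    intro p hp
    by_cases hpU : p ∈ U
    · obtain rfl := (hUD le_rfl hpU hp).1
      rw [hEU _ le_rfl, tr_refl, hcb']
    · simp only [E, dif_neg hpU, if_pos hp]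
  have hΞD : ∀ p (h : p ≤ b) v, Ξ p v = ξ (tr V h v) := by
    intro p h v
    by_cases hp : p ∈ D
    · simp only [Ξ, dif_pos hp, LinearMap.comp_apply]
    · have h0 : ξ (tr V h v) = 0 := by
        by_contra h0
        exact hp ((hD p).2 ⟨h, v, h0⟩)
      have hpU : p ∉ U := fun hpU => hp (le_antisymm (hUb hpU) h ▸ hbD)
      simp only [Ξ, dif_neg hp, if_neg hpU, h0, LinearMap.zero_apply]
  have hΞU : ∀ p ∈ U, Ξ p = η p := by
    intro p hp
    by_cases hpD : p ∈ D
    · obtain rfl := (hUD le_rfl hp hpD).1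
      ext v
      rw [hΞD _ le_rfl, tr_refl, hηb']
    · simp only [Ξ, dif_neg hpD, if_pos hp]
  have hcomp : ∀ p ∈ U ∪ D, p ≤ b ∨ b ≤ p := fun p hp =>
    hp.elim (fun h => Or.inr (hUb h)) fun h => Or.inl (hDb h)
  refine ⟨{
    I := ⟨U ∪ D, ⟨b, Or.inl hbU⟩, ?_, ?_⟩
    e := E
    ξ := Ξ
    e_eq_zero := ?_
    tr_e := ?_
    ξ_eq_zero := ?_
    ξ_tr := ?_
    ξ_e := ?_ }⟩
  · intro p hp q hq r hpr hrq
    have hr : b ≤ r ∨ r ≤ b := by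
      rcases hq with hq | hq
      · exact hU' r q hrq hq
      · exact Or.inr (hrq.trans (hDb hq))
    rcases hr with hr | hr
    · left
      rcases hq with hq | hq
      · exact hUU hr hrq hq
      · exact le_antisymm hr (hrq.trans (hDb hq)) ▸ hbU
    · right
      rcases hp with hp | hp
      · exact le_antisymm ((hUb hp).trans hpr) hr ▸ hbD
      · exact hDD hr hpr hp
  · intro p hp q hq
    refine Relation.ReflTransGen.tail (b := b) (Relation.ReflTransGen.single ?_) ?_
    · exact ⟨hp, Or.inl hbU, hcomp p hp⟩
    · exact ⟨Or.inl hbU, hq, (hcomp q hq).symm⟩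
  · intro p hp
    simp only [E, dif_neg fun h => hp (Or.inl h), if_neg fun h => hp (Or.inr h)]
  · intro p q h hp
    rcases hp with hp | hp
    · rw [hEU p (hUb hp), hEU q ((hUb hp).trans h), tr_tr]
    · rw [hED p hp]
      rcases hD' p q h hp with hq | hq
      · rw [hEU q hq, ← hcb p hp (hDb hp), tr_tr]
      · have hqD := hDD hq h hp
        rw [hED q hqD, hc h hp hqD]
  · intro p hp
    simp only [Ξ, dif_neg fun h => hp (Or.inr h), if_neg fun h => hp (Or.inl h)]
  · intro p q h hq v
    rcases hq with hq | hq
    · rcases hU' p q h hq with hp | hp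
      · have hpU := hUU hp h hq
        rw [hΞU q hq, hΞU p hpU, hη h hpU hq]
      · rw [hΞU q hq, hΞD p hp, ← hηb q hq (hUb hq), tr_tr]
    · rw [hΞD q (hDb hq), hΞD p (h.trans (hDb hq)), tr_tr]
  · intro p hp
    rcases hp with hp | hp
    · rw [hΞU p hp, hEU p (hUb hp), hηb p hp, he]
    · rw [hΞD p (hDb hp), hED p hp, hcb p hp, he]

end Extension

/-! ### The order of the bipath poset -/

namespace Pt

theorem negInf_le (x : Pt) : negInf ≤ x := Or.inl rfl

theorem le_posInf (x : Pt) : x ≤ posInf := Or.inr (Or.inl rfl)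

theorem real_le_real {s t : ℝ} {i j : Fin 2} : real s i ≤ real t j ↔ i = j ∧ s ≤ t := by
  constructor
  · rintro (h | h | ⟨_, _, _, h, h', hst⟩)
    · cases h
    · cases h
    · cases h; cases h'; exact ⟨rfl, hst⟩
  · rintro ⟨rfl, h⟩
    exact Or.inr (Or.inr ⟨s, t, i, rfl, rfl, h⟩)

theorem le_negInf {x : Pt} : x ≤ negInf ↔ x = negInf :=
  ⟨fun h => le_antisymm h (negInf_le x), fun h => h.le⟩

theorem posInf_le {x : Pt} : posInf ≤ x ↔ x = posInf :=
  ⟨fun h => le_antisymm (le_posInf x) h, fun h => h.ge⟩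

theorem real_le {s : ℝ} {i : Fin 2} {y : Pt} :
    real s i ≤ y ↔ y = posInf ∨ ∃ t, y = real t i ∧ s ≤ t := by
  cases y with
  | negInf => simp [le_negInf]
  | posInf => simp [le_posInf]
  | real t j => simp only [real_le_real]; aesop

theorem le_real {t : ℝ} {i : Fin 2} {x : Pt} :
    x ≤ real t i ↔ x = negInf ∨ ∃ s, x = real s i ∧ s ≤ t := by
  cases x with
  | negInf => simp [negInf_le]
  | posInf => simp [posInf_le]
  | real s j => simp only [real_le_real]; aesop

/-- One of the two maximal chains of the bipath poset. -/
def line (i : Fin 2) : Set Pt := {p | p = negInf ∨ p = posInf ∨ ∃ t, p = real t i}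

theorem isChain_line (i : Fin 2) : IsChain (· ≤ ·) (line i) := by
  rintro x (rfl | rfl | ⟨s, rfl⟩) y (rfl | rfl | ⟨t, rfl⟩) -
  all_goals simp [negInf_le, le_posInf, real_le_real, le_total]

theorem directedOn_ge_of_subset_line {i : Fin 2} {S : Set Pt} (hS : S ⊆ line i) :
    DirectedOn (· ≥ ·) S := by
  intro x hx y hy
  rcases (isChain_line i).total (hS hx) (hS hy) with h | h
  · exact ⟨x, hx, le_rfl, h⟩
  · exact ⟨y, hy, h, le_rfl⟩

theorem exists_mem_line (p : Pt) : ∃ i, p ∈ line i := by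
  cases p with
  | negInf => exact ⟨0, Or.inl rfl⟩
  | posInf => exact ⟨0, Or.inr (Or.inl rfl)⟩
  | real t i => exact ⟨i, Or.inr (Or.inr ⟨t, rfl⟩)⟩

theorem mem_line_of_le_real {p : Pt} {t : ℝ} {i : Fin 2} (h : p ≤ real t i) : p ∈ line i := by
  rcases le_real.1 h with h | ⟨s, h, -⟩
  · exact Or.inl h
  · exact Or.inr (Or.inr ⟨s, h⟩)

theorem mem_line_of_real_le {p : Pt} {t : ℝ} {i : Fin 2} (h : real t i ≤ p) : p ∈ line i := by
  rcases real_le.1 h with h | ⟨s, h, -⟩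
  · exact Or.inr (Or.inl h)
  · exact Or.inr (Or.inr ⟨s, h⟩)

end Pt

/-! ### Nonzero bipath modules have interval summands -/

section Existence

variable {k : Type u} [Field k]

theorem isChain_ker {P : Type v} [PartialOrder P] (V : PersMod k P) (b : P) {S : Set P}
    (hS : IsChain (· ≤ ·) S) :
    IsChain (· ≤ ·) {K : Submodule k (V.obj b) | ∃ p ∈ S, ∃ h : b ≤ p,
      K = LinearMap.ker (tr V h)} := by
  have key : ∀ {p q} (hp : b ≤ p) (hq : b ≤ q), p ≤ q →
      LinearMap.ker (tr V hp) ≤ LinearMap.ker (tr V hq) := by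
    intro p q hp hq h x hx
    rw [LinearMap.mem_ker] at hx ⊢
    rw [← tr_tr V hp h, hx, map_zero]
  rintro _ ⟨p, hp, hbp, rfl⟩ _ ⟨q, hq, hbq, rfl⟩ -
  exact (hS.total hp hq).imp (key hbp hbq) (key hbq hbp)

theorem isChain_range {P : Type v} [PartialOrder P] (V : PersMod k P) (b : P) {S : Set P}
    (hS : IsChain (· ≤ ·) S) :
    IsChain (· ≤ ·) {K : Submodule k (V.obj b) | ∃ p ∈ S, ∃ h : p ≤ b,
      K = LinearMap.range (tr V h)} := by
  have key : ∀ {p q} (hp : p ≤ b) (hq : q ≤ b), p ≤ q →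
      LinearMap.range (tr V hp) ≤ LinearMap.range (tr V hq) := by
    rintro p q hp hq h _ ⟨x, rfl⟩
    exact ⟨tr V h x, tr_tr V h hq x⟩
  rintro _ ⟨p, hp, hbp, rfl⟩ _ ⟨q, hq, hbq, rfl⟩ -
  exact (hS.total hp hq).imp (key hbp hbq) (key hbq hbp)

/-- The kernels of the maps out of `V_{-∞}` form one chain for each line. The choice of `e` and `ξ`
ensures that `ξ` vanishes on every kernel not containing `e`, which is the condition for extending
it. -/
theorem exists_intervalSummand_of_negInf (V : PersMod k Pt) (hV : IsPfd V)
    (hne : Nontrivial (V.obj Pt.negInf)) : Nonempty (IntervalSummand V) := by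
  classical
  have := hV Pt.negInf
  obtain ⟨e, ξ, he, hK⟩ := exists_vector_functional
    (isChain_ker V Pt.negInf (Pt.isChain_line 0)) (isChain_ker V Pt.negInf (Pt.isChain_line 1))
  let U : Set Pt := {p | ∃ h : Pt.negInf ≤ p, tr V h e ≠ 0}
  let D : Set Pt := {p | ∃ h : p ≤ Pt.negInf, ∃ x, ξ (tr V h x) ≠ 0}
  have hker : ∀ p (hp : p ∈ U) x, tr V (Pt.negInf_le p) x = 0 → ξ x = 0 := by
    intro p ⟨h, hp⟩ x hx
    rcases hK (LinearMap.ker (tr V h)) (by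
      obtain ⟨i, hi⟩ := Pt.exists_mem_line p
      fin_cases i
      · exact Or.inl ⟨p, hi, h, rfl⟩
      · exact Or.inr ⟨p, hi, h, rfl⟩) with h' | h'
    · exact absurd (LinearMap.mem_ker.1 h') hp
    · exact h' x (LinearMap.mem_ker.2 hx)
  have hbU : Pt.negInf ∈ U := ⟨le_rfl, fun h => by
    rw [tr_refl] at h
    simp [h] at he⟩
  obtain ⟨η, h1, h2⟩ : ∃ η : ∀ p, V.obj p →ₗ[k] k,
      (∀ {p q} (h : p ≤ q), p ∈ U → q ∈ U → ∀ v, η q (tr V h v) = η p v) ∧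
      ∀ p, p ∈ U → ∀ x, η p (tr V (Pt.negInf_le p) x) = ξ x := by
    -- If `e` survives at `+∞`, then `U` is directed and one extension suffices, compatible on both
    -- lines. Otherwise `U` consists of two chains meeting only in `-∞`, and separate extensions
    -- along them glue.
    by_cases htop : Pt.posInf ∈ U
    · exact exists_extension V
        (fun p _ q _ => ⟨Pt.posInf, htop, Pt.le_posInf p, Pt.le_posInf q⟩) ⟨_, htop⟩
        (fun p _ => Pt.negInf_le p) ξ hker
    · choose η h1 h2 using fun i => exists_extension V (T := U ∩ Pt.line i)
        ((Pt.isChain_line i).mono Set.inter_subset_right).directedOn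
        ⟨Pt.negInf, hbU, Or.inl rfl⟩ (fun p _ => Pt.negInf_le p) ξ (fun p hp => hker p hp.1)
      have hb : ∀ i x, η i Pt.negInf x = ξ x := fun i x => by
        simpa [tr_refl] using h2 i Pt.negInf ⟨hbU, Or.inl rfl⟩ x
      have hp : ∀ p ∈ U, p = Pt.negInf ∨ ∃ t i, p = Pt.real t i := by
        rintro (_ | _ | ⟨t, i⟩) hp
        · exact Or.inl rfl
        · exact absurd hp htop
        · exact Or.inr ⟨t, i, rfl⟩
      refine ⟨fun p => match p with
        | .negInf => ξ
        | .posInf => 0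
        | .real t i => η i (.real t i), ?_, ?_⟩
      · intro p q h hpU hqU v
        rcases hp q hqU with rfl | ⟨t, i, rfl⟩
        · obtain rfl := Pt.le_negInf.1 h
          rw [tr_refl]
        · rcases Pt.le_real.1 h with rfl | ⟨s, rfl, -⟩
          · exact h2 i _ ⟨hqU, Or.inr (Or.inr ⟨t, rfl⟩)⟩ v
          · exact h1 i h ⟨hpU, Or.inr (Or.inr ⟨s, rfl⟩)⟩ ⟨hqU, Or.inr (Or.inr ⟨t, rfl⟩)⟩ v
      · intro p hpU x
        rcases hp p hpU with rfl | ⟨t, i, rfl⟩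
        · simp only [tr_refl]
        · exact h2 i _ ⟨hpU, Or.inr (Or.inr ⟨t, rfl⟩)⟩ x
  refine exists_intervalSummand_of_star V Pt.negInf e ξ he U D (fun _ => Iff.rfl)
    (fun _ => Iff.rfl) (fun p _ _ _ => Or.inl (Pt.negInf_le p))
    (fun _ q _ _ => Or.inl (Pt.negInf_le q)) η h1 (fun p hp _ v => h2 p hp v)
    (fun p => tr V (Pt.negInf_le p) e) (fun h _ _ => tr_tr V _ _ _) fun p _ h => ?_
  rw [tr_tr, tr_refl]

/-- Dual to the case of `-∞`: the chains are the images in `V_{+∞}` along the two lines, and `e`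
lies in every image on which `ξ` does not vanish, so it lifts. -/
theorem exists_intervalSummand_of_posInf (V : PersMod k Pt) (hV : IsPfd V)
    (hne : Nontrivial (V.obj Pt.posInf)) : Nonempty (IntervalSummand V) := by
  classical
  have := hV Pt.posInf
  obtain ⟨e, ξ, he, hK⟩ := exists_vector_functional
    (isChain_range V Pt.posInf (Pt.isChain_line 0)) (isChain_range V Pt.posInf (Pt.isChain_line 1))
  let U : Set Pt := {p | ∃ h : Pt.posInf ≤ p, tr V h e ≠ 0}
  let D : Set Pt := {p | ∃ h : p ≤ Pt.posInf, ∃ x, ξ (tr V h x) ≠ 0}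
  have hran : ∀ p (hp : p ∈ D), ∃ x, tr V (Pt.le_posInf p) x = e := by
    intro p ⟨h, x, hp⟩
    rcases hK (LinearMap.range (tr V h)) (by
      obtain ⟨i, hi⟩ := Pt.exists_mem_line p
      fin_cases i
      · exact Or.inl ⟨p, hi, h, rfl⟩
      · exact Or.inr ⟨p, hi, h, rfl⟩) with h' | h'
    · exact h'
    · exact absurd (h' _ ⟨x, rfl⟩) hp
  have hbD : Pt.posInf ∈ D := ⟨le_rfl, e, by simp [tr_refl, he]⟩
  obtain ⟨c, h1, h2⟩ : ∃ c : ∀ p, V.obj p,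
      (∀ {p q} (h : p ≤ q), p ∈ D → q ∈ D → tr V h (c p) = c q) ∧
      ∀ p, p ∈ D → tr V (Pt.le_posInf p) (c p) = e := by
    by_cases hbot : Pt.negInf ∈ D
    · exact exists_lift V hV
        (fun p _ q _ => ⟨Pt.negInf, hbot, Pt.negInf_le p, Pt.negInf_le q⟩) ⟨_, hbot⟩
        (fun p _ => Pt.le_posInf p) e hran
    · choose c h1 h2 using fun i => exists_lift V hV (T := D ∩ Pt.line i)
        (Pt.directedOn_ge_of_subset_line Set.inter_subset_right)
        ⟨Pt.posInf, hbD, Or.inr (Or.inl rfl)⟩ (fun p _ => Pt.le_posInf p) e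
        (fun p hp => hran p hp.1)
      have hp : ∀ p ∈ D, p = Pt.posInf ∨ ∃ t i, p = Pt.real t i := by
        rintro (_ | _ | ⟨t, i⟩) hp
        · exact absurd hp hbot
        · exact Or.inl rfl
        · exact Or.inr ⟨t, i, rfl⟩
      refine ⟨fun p => match p with
        | .negInf => 0
        | .posInf => e
        | .real t i => c i (.real t i), ?_, ?_⟩
      · intro p q h hpD hqD
        rcases hp p hpD with rfl | ⟨s, i, rfl⟩
        · obtain rfl := Pt.posInf_le.1 h
          rw [tr_refl]
        · rcases Pt.real_le.1 h with rfl | ⟨t, rfl, -⟩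
          · exact h2 i _ ⟨hpD, Or.inr (Or.inr ⟨s, rfl⟩)⟩
          · exact h1 i h ⟨hpD, Or.inr (Or.inr ⟨s, rfl⟩)⟩ ⟨hqD, Or.inr (Or.inr ⟨t, rfl⟩)⟩
      · intro p hpD
        rcases hp p hpD with rfl | ⟨t, i, rfl⟩
        · simp only [tr_refl]
        · exact h2 i _ ⟨hpD, Or.inr (Or.inr ⟨t, rfl⟩)⟩
  refine exists_intervalSummand_of_star V Pt.posInf e ξ he U D (fun _ => Iff.rfl)
    (fun _ => Iff.rfl) (fun p _ _ _ => Or.inr (Pt.le_posInf p))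
    (fun _ q _ _ => Or.inr (Pt.le_posInf q)) (fun p => ξ ∘ₗ tr V (Pt.le_posInf p))
    (fun h _ _ v => congrArg ξ (tr_tr V _ _ _)) (fun p _ h v => ?_)
    c h1 (fun p hp _ => h2 p hp)
  rw [LinearMap.comp_apply, tr_tr, tr_refl]

/-- Nothing survives at `±∞`, so only the line through the point matters; its kernels and its images
are the two chains. -/
theorem exists_intervalSummand_of_real (V : PersMod k Pt) (hV : IsPfd V)
    (hbot : Subsingleton (V.obj Pt.negInf)) (htop : Subsingleton (V.obj Pt.posInf)) (r : ℝ)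
    (i : Fin 2) (hne : Nontrivial (V.obj (Pt.real r i))) : Nonempty (IntervalSummand V) := by
  classical
  have := hV (Pt.real r i)
  set b := Pt.real r i with hb
  obtain ⟨e, ξ, he, hK⟩ := exists_vector_functional
    (isChain_ker V b (Pt.isChain_line i)) (isChain_range V b (Pt.isChain_line i))
  let U : Set Pt := {p | ∃ h : b ≤ p, tr V h e ≠ 0}
  let D : Set Pt := {p | ∃ h : p ≤ b, ∃ x, ξ (tr V h x) ≠ 0}
  have hbU : b ∈ U := ⟨le_rfl, fun h => by
    rw [tr_refl] at h
    simp [h] at he⟩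
  have hbD : b ∈ D := ⟨le_rfl, e, by simp [tr_refl, he]⟩
  have hUline : U ⊆ Pt.line i := fun p hp => Pt.mem_line_of_real_le hp.1
  have hDline : D ⊆ Pt.line i := fun p hp => Pt.mem_line_of_le_real hp.1
  obtain ⟨η, h1, h2⟩ := exists_extension V (T := U) ((Pt.isChain_line i).mono hUline).directedOn
    ⟨b, hbU⟩ (fun p hp => hp.1) ξ (by
      rintro p ⟨h, hp⟩ x hx
      rcases hK _ (Or.inl ⟨p, hUline ⟨h, hp⟩, h, rfl⟩) with h' | h'
      · exact absurd (LinearMap.mem_ker.1 h') hp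
      · exact h' x (LinearMap.mem_ker.2 hx))
  obtain ⟨c, h3, h4⟩ := exists_lift V hV (T := D)
    (Pt.directedOn_ge_of_subset_line hDline) ⟨b, hbD⟩ (fun p hp => hp.1) e (by
      rintro p ⟨h, x, hp⟩
      rcases hK _ (Or.inr ⟨p, hDline ⟨h, x, hp⟩, h, rfl⟩) with h' | h'
      · exact h'
      · exact absurd (h' _ ⟨x, rfl⟩) hp)
  refine exists_intervalSummand_of_star V b e ξ he U D (fun _ => Iff.rfl) (fun _ => Iff.rfl)
    ?_ ?_ η h1 (fun p hp _ v => h2 p hp v) c h3 (fun p hp _ => h4 p hp)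
  · rintro p q hpq ⟨h, hq⟩
    rcases Pt.real_le.1 h with rfl | ⟨t, rfl, -⟩
    · exact absurd (Subsingleton.elim _ _) hq
    · exact (Pt.isChain_line i).total (hUline hbU) (Pt.mem_line_of_le_real hpq)
  · rintro p q hpq ⟨h, x, hx⟩
    rcases Pt.le_real.1 h with rfl | ⟨t, rfl, -⟩
    · rw [Subsingleton.elim x 0, map_zero, map_zero] at hx
      exact absurd rfl hx
    · exact (Pt.isChain_line i).total (hUline hbU) (Pt.mem_line_of_real_le hpq)

theorem exists_intervalSummand (V : PersMod k Pt) (hV : IsPfd V) (p : Pt)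
    (hp : Nontrivial (V.obj p)) : Nonempty (IntervalSummand V) := by
  rcases subsingleton_or_nontrivial (V.obj Pt.negInf) with hbot | hbot
  · rcases subsingleton_or_nontrivial (V.obj Pt.posInf) with htop | htop
    · cases p with
      | negInf => exact absurd hbot (not_subsingleton_iff_nontrivial.2 hp)
      | posInf => exact absurd htop (not_subsingleton_iff_nontrivial.2 hp)
      | real r i => exact exists_intervalSummand_of_real V hV hbot htop r i hp
    · exact exists_intervalSummand_of_posInf V hV htop
  · exact exists_intervalSummand_of_negInf V hV hbot

end Existence

/-! ### Decomposition into interval modules -/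

section Decomposition

variable {k : Type u} [Field k]

/-- The submodule of a persistence module given by pointwise subspaces. -/
def subMod {P : Type v} [PartialOrder P] (V : PersMod k P) (C : ∀ p, Submodule k (V.obj p))
    (hC : ∀ {p q} (h : p ≤ q), ∀ v ∈ C p, tr V h v ∈ C q) : PersMod k P where
  obj p := ModuleCat.of k (C p)
  map {p q} f := ModuleCat.ofHom ((tr V (leOfHom f)).restrict (hC (leOfHom f)))
  map_id p := by
    ext v
    exact tr_refl V _ v.1
  map_comp f g := by
    ext v
    exact (tr_tr V _ _ v.1).symm

/-- Finitely many summands are alive at each point, so subtracting their projections defines a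
projection of `V` onto the common kernel `C` of all functionals, compatible with the structure maps.
`C` is nonzero because of `v`; an interval summand of `C`, with its functionals composed with this
projection, is a summand of `V` orthogonal to the family. -/
theorem Orthogonal.exists_extend {P : Type v} [PartialOrder P]
    (hP : ∀ V : PersMod k P, IsPfd V → ∀ p, Nontrivial (V.obj p) → Nonempty (IntervalSummand V))
    {V : PersMod k P} (hV : IsPfd V) {ι : Type w} {s : ι → IntervalSummand V} (hs : Orthogonal s)
    {p : P} {v : V.obj p} (hv : ∀ i, (s i).ξ p v = 0) (hv0 : v ≠ 0) :
    ∃ t : IntervalSummand V, ∀ i p, (s i).ξ p (t.e p) = 0 ∧ t.ξ p ((s i).e p) = 0 := by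
  classical
  let C : ∀ p, Submodule k (V.obj p) := fun p => ⨅ i, LinearMap.ker ((s i).ξ p)
  have hCmem : ∀ {p} {v : V.obj p}, v ∈ C p ↔ ∀ i, (s i).ξ p v = 0 := by
    simp [C, Submodule.mem_iInf]
  have hC : ∀ {p q} (h : p ≤ q), ∀ v ∈ C p, tr V h v ∈ C q := by
    intro p q h v hv
    rw [hCmem] at hv ⊢
    intro i
    by_cases hq : q ∈ (s i).I.carrier
    · rw [(s i).ξ_tr h hq, hv i]
    · rw [(s i).ξ_eq_zero q hq, LinearMap.zero_apply]
  have hfin : ∀ p, {i | p ∈ (s i).I.carrier}.Finite := hs.finite hV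
  let π : ∀ p, V.obj p →ₗ[k] V.obj p := fun p =>
    LinearMap.id - ∑ i ∈ (hfin p).toFinset, (LinearMap.toSpanSingleton k _ ((s i).e p)) ∘ₗ (s i).ξ p
  have hπ : ∀ p v, π p v = v - ∑ i ∈ (hfin p).toFinset, (s i).ξ p v • (s i).e p := by
    intro p v
    simp [π]
  have hπ' : ∀ p (T : Finset ι), (hfin p).toFinset ⊆ T → ∀ v,
      π p v = v - ∑ i ∈ T, (s i).ξ p v • (s i).e p := by
    intro p T hT v
    rw [hπ, Finset.sum_subset hT]
    intro i _ hi
    rw [(s i).e_eq_zero p (by simpa using hi), smul_zero]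
  have hπC : ∀ p v, π p v ∈ C p := by
    intro p v
    rw [hCmem]
    intro i
    by_cases hp : p ∈ (s i).I.carrier
    · rw [hπ, map_sub, map_sum, Finset.sum_eq_single i]
      · rw [map_smul, (s i).ξ_e p hp, smul_eq_mul, mul_one, sub_self]
      · intro j _ hj
        rw [map_smul, hs i j hj.symm, smul_zero]
      · exact fun h => absurd (by simpa using hp) h
    · rw [(s i).ξ_eq_zero p hp, LinearMap.zero_apply]
  have hπtr : ∀ {p q} (h : p ≤ q) v, π q (tr V h v) = tr V h (π p v) := by
    intro p q h v
    rw [hπ' p _ (Finset.subset_union_left (s₂ := (hfin q).toFinset)),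
      hπ' q _ (Finset.subset_union_right (s₁ := (hfin p).toFinset)), map_sub, map_sum]
    simp_rw [(s _).tr_smul h]
  have hπid : ∀ p v, v ∈ C p → π p v = v := by
    intro p v hv
    rw [hπ, Finset.sum_eq_zero, sub_zero]
    intro i _
    rw [hCmem.1 hv i, zero_smul]
  have hπe : ∀ i p, π p ((s i).e p) = 0 := by
    intro i p
    by_cases hp : p ∈ (s i).I.carrier
    · rw [hπ, Finset.sum_eq_single i, (s i).ξ_e p hp, one_smul, sub_self]
      · intro j _ hj
        rw [hs j i hj, zero_smul]
      · exact fun h => absurd (by simpa using hp) h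
    · rw [(s i).e_eq_zero p hp, map_zero]
  let X := subMod V C hC
  have hX : IsPfd X := fun p => by
    have := hV p
    exact inferInstanceAs (Module.Finite k (C p))
  have hXp : Nontrivial (X.obj p) :=
    ⟨⟨(⟨v, hCmem.2 hv⟩ : C p), (0 : C p), fun h => hv0 (congrArg Subtype.val h)⟩⟩
  obtain ⟨t⟩ := hP X hX p hXp
  let inc : ∀ p, X.obj p →ₗ[k] V.obj p := fun p => (C p).subtype
  have hinc : ∀ {p q} (h : p ≤ q) x, inc q (tr X h x) = tr V h (inc p x) := fun h x => rfl
  have hincC : ∀ p x, inc p x ∈ C p := fun p x => Subtype.property (p := fun y => y ∈ C p) x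
  let pr : ∀ p, V.obj p →ₗ[k] X.obj p := fun p => (π p).codRestrict (C p) (hπC p)
  have hincpr : ∀ p v, inc p (pr p v) = π p v := fun p v => rfl
  have hinj : ∀ p, Function.Injective (inc p) := fun p => Subtype.val_injective
  have hprtr : ∀ {p q} (h : p ≤ q) v, pr q (tr V h v) = tr X h (pr p v) := fun {p q} h v => by
    apply hinj
    rw [hincpr, hinc, hincpr, hπtr]
  have hprinc : ∀ p x, pr p (inc p x) = x := fun p x => by
    apply hinj
    rw [hincpr, hπid p _ (hincC p x)]
  refine ⟨⟨t.I, fun p => inc p (t.e p), fun p => t.ξ p ∘ₗ pr p, ?_, ?_, ?_, ?_, ?_⟩, ?_⟩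
  · intro p hp
    rw [t.e_eq_zero p hp, map_zero]
  · intro p q h hp
    rw [← hinc, t.tr_e h hp]
  · intro p hp
    rw [t.ξ_eq_zero p hp, LinearMap.zero_comp]
  · intro p q h hq v
    rw [LinearMap.comp_apply, hprtr, t.ξ_tr h hq, LinearMap.comp_apply]
  · intro p hp
    rw [LinearMap.comp_apply, hprinc, t.ξ_e p hp]
  · intro i p
    refine ⟨hCmem.1 (hincC p _) i, ?_⟩
    have : pr p ((s i).e p) = 0 := hinj p (by rw [hincpr, hπe, map_zero])
    rw [LinearMap.comp_apply, this, map_zero]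

/-- If every nonzero pointwise finite-dimensional module has an interval summand, then all
pointwise finite-dimensional modules have an interval basis. -/
theorem exists_isIntervalBasis_of_exists_summand {P : Type v} [PartialOrder P]
    (hP : ∀ V : PersMod k P, IsPfd V → ∀ p, Nontrivial (V.obj p) → Nonempty (IntervalSummand V))
    (V : PersMod k P) (hV : IsPfd V) :
    ∃ S : Set (IntervalSummand V), IsIntervalBasis (fun s : S => s.1) := by
  let R : IntervalSummand V → IntervalSummand V → Prop := fun s t => ∀ p, s.ξ p (t.e p) = 0
  obtain ⟨S, hS⟩ := zorn_subset {S : Set (IntervalSummand V) | S.Pairwise R} (by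
    intro c hc hchain
    exact ⟨⋃₀ c, (Set.pairwise_sUnion hchain.directedOn).2 fun s hs => hc hs,
      fun s hs => Set.subset_sUnion_of_mem hs⟩)
  have hort : Orthogonal (fun s : S => s.1) := fun i j hij =>
    hS.prop i.2 j.2 fun h => hij (Subtype.ext h)
  refine ⟨S, hort, fun p v hv => ?_⟩
  by_contra hv0
  obtain ⟨t, ht⟩ := hort.exists_extend hP hV hv hv0
  have htS : t ∉ S := by
    intro htS
    obtain ⟨q, hq⟩ := t.I.nonempty
    have := (ht ⟨t, htS⟩ q).1
    rw [t.ξ_e q hq] at this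
    exact one_ne_zero this
  have hins : (insert t S).Pairwise R := by
    rw [Set.pairwise_insert]
    exact ⟨hS.prop, fun s hs _ => ⟨fun p => (ht ⟨s, hs⟩ p).2, fun p => (ht ⟨s, hs⟩ p).1⟩⟩
  exact htS (hS.le_of_ge hins (Set.subset_insert t S) (Set.mem_insert t S))

theorem exists_isIntervalBasis (V : PersMod k Pt) (hV : IsPfd V) :
    ∃ S : Set (IntervalSummand V), IsIntervalBasis (fun s : S => s.1) :=
  exists_isIntervalBasis_of_exists_summand exists_intervalSummand V hV

end Decomposition

/-! ### Types and ends of the intervals of the bipath poset -/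

section Types

variable {I J : PosetInterval Pt}

theorem mem_of_negInf_mem (hI : Pt.negInf ∈ I.carrier) {s t : ℝ} {i : Fin 2} (hst : s ≤ t)
    (ht : Pt.real t i ∈ I.carrier) : Pt.real s i ∈ I.carrier :=
  I.convex _ hI _ ht _ (Pt.negInf_le _) (Pt.real_le_real.2 ⟨rfl, hst⟩)

theorem mem_of_posInf_mem (hI : Pt.posInf ∈ I.carrier) {s t : ℝ} {i : Fin 2} (hst : s ≤ t)
    (hs : Pt.real s i ∈ I.carrier) : Pt.real t i ∈ I.carrier :=
  I.convex _ hs _ hI _ (Pt.real_le_real.2 ⟨rfl, hst⟩) (Pt.le_posInf _)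

theorem exists_real_mem (h1 : Pt.negInf ∉ I.carrier) (h2 : Pt.posInf ∉ I.carrier) {p : Pt}
    (hp : p ∈ I.carrier) : ∃ t i, p = Pt.real t i := by
  cases p with
  | negInf => exact absurd hp h1
  | posInf => exact absurd hp h2
  | real t i => exact ⟨t, i, rfl⟩

/-- An interval avoiding `-∞` and `+∞` lies in one of the two lines. -/
theorem line_unique (h1 : Pt.negInf ∉ I.carrier) (h2 : Pt.posInf ∉ I.carrier) {s t : ℝ}
    {i j : Fin 2} (hs : Pt.real s i ∈ I.carrier) (ht : Pt.real t j ∈ I.carrier) : i = j := by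
  have key : ∀ q, Relation.ReflTransGen
      (fun a b => a ∈ I.carrier ∧ b ∈ I.carrier ∧ (a ≤ b ∨ b ≤ a)) (Pt.real s i) q →
      ∃ r, q = Pt.real r i := by
    intro q hq
    induction hq with
    | refl => exact ⟨s, rfl⟩
    | tail _ hbc ih =>
      obtain ⟨r, rfl⟩ := ih
      obtain ⟨-, hc, h⟩ := hbc
      obtain ⟨r', l, rfl⟩ := exists_real_mem h1 h2 hc
      rcases h with h | h
      · exact ⟨r', by rw [(Pt.real_le_real.1 h).1]⟩
      · exact ⟨r', by rw [(Pt.real_le_real.1 h).1]⟩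
  obtain ⟨r, hr⟩ := key _ (I.connected _ hs _ ht)
  cases hr
  rfl

open Classical in
/-- The type of an interval: whether it contains `-∞` and `+∞`, and, if it contains neither, the
line in which it lies. -/
def typ (I : PosetInterval Pt) : Prop × Prop × Fin 2 :=
  (Pt.negInf ∈ I.carrier, Pt.posInf ∈ I.carrier,
    if Pt.negInf ∈ I.carrier ∨ Pt.posInf ∈ I.carrier then 0 else
      if ∃ r, Pt.real r 0 ∈ I.carrier then 0 else 1)

theorem negInf_mem_iff (h : typ I = typ J) : Pt.negInf ∈ I.carrier ↔ Pt.negInf ∈ J.carrier :=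
  iff_of_eq (congrArg (fun x => x.1) h)

theorem posInf_mem_iff (h : typ I = typ J) : Pt.posInf ∈ I.carrier ↔ Pt.posInf ∈ J.carrier :=
  iff_of_eq (congrArg (fun x => x.2.1) h)

open Classical in
theorem typ_eq (h1 : Pt.negInf ∉ I.carrier) (h2 : Pt.posInf ∉ I.carrier) {t : ℝ} {i : Fin 2}
    (ht : Pt.real t i ∈ I.carrier) : typ I = (False, False, i) := by
  have h3 : (if ∃ r, Pt.real r 0 ∈ I.carrier then 0 else 1) = i := by
    split_ifs with h
    · obtain ⟨r, hr⟩ := h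
      exact line_unique h1 h2 hr ht
    · match i with
      | 0 => exact absurd ⟨t, ht⟩ h
      | 1 => rfl
  simp only [typ, h1, h2, or_self, if_false, h3]

theorem line_eq (h : typ I = typ J) (h1 : Pt.negInf ∉ I.carrier) (h2 : Pt.posInf ∉ I.carrier)
    {s t : ℝ} {i j : Fin 2} (hs : Pt.real s i ∈ I.carrier) (ht : Pt.real t j ∈ J.carrier) :
    i = j := by
  have hJ := typ_eq (fun h' => h1 ((negInf_mem_iff h).2 h'))
    (fun h' => h2 ((posInf_mem_iff h).2 h')) ht
  rw [← h, typ_eq h1 h2 hs] at hJ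
  exact congrArg (fun x => x.2.2) hJ

theorem typ_eq_typ (h1 : Pt.negInf ∈ I.carrier ↔ Pt.negInf ∈ J.carrier)
    (h2 : Pt.posInf ∈ I.carrier ↔ Pt.posInf ∈ J.carrier)
    (h3 : Pt.negInf ∉ I.carrier → Pt.posInf ∉ I.carrier →
      ∃ s t i, Pt.real s i ∈ I.carrier ∧ Pt.real t i ∈ J.carrier) : typ I = typ J := by
  by_cases h : Pt.negInf ∈ I.carrier ∨ Pt.posInf ∈ I.carrier
  · have h' : Pt.negInf ∈ J.carrier ∨ Pt.posInf ∈ J.carrier := by rwa [← h1, ← h2]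
    simp only [typ, if_pos h, if_pos h', h1, h2]
  · push Not at h
    obtain ⟨s, t, i, hs, ht⟩ := h3 h.1 h.2
    rw [typ_eq h.1 h.2 hs, typ_eq (fun h' => h.1 (h1.2 h')) (fun h' => h.2 (h2.2 h')) ht]

open Classical in
/-- The two ends of an interval, as lower sets of the real line. -/
def lowerEnd (I : PosetInterval Pt) (j : Fin 2) : Set ℝ :=
  if Pt.negInf ∈ I.carrier then {t | Pt.real t j ∈ I.carrier}
  else if Pt.posInf ∈ I.carrier then {t | Pt.real t j ∉ I.carrier}
  else if j = 0 then {t | ∀ u i, Pt.real u i ∈ I.carrier → t < u}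
  else {t | ∃ u i, Pt.real u i ∈ I.carrier ∧ t ≤ u}

theorem lowerEnd_of_negInf (h : Pt.negInf ∈ I.carrier) (j : Fin 2) :
    lowerEnd I j = {t | Pt.real t j ∈ I.carrier} := by
  simp [lowerEnd, h]

theorem lowerEnd_of_posInf (h : Pt.negInf ∉ I.carrier) (h' : Pt.posInf ∈ I.carrier) (j : Fin 2) :
    lowerEnd I j = {t | Pt.real t j ∉ I.carrier} := by
  simp [lowerEnd, h, h']

theorem lowerEnd_zero (h : Pt.negInf ∉ I.carrier) (h' : Pt.posInf ∉ I.carrier) :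
    lowerEnd I 0 = {t | ∀ u i, Pt.real u i ∈ I.carrier → t < u} := by
  simp [lowerEnd, h, h']

theorem lowerEnd_one (h : Pt.negInf ∉ I.carrier) (h' : Pt.posInf ∉ I.carrier) :
    lowerEnd I 1 = {t | ∃ u i, Pt.real u i ∈ I.carrier ∧ t ≤ u} := by
  simp [lowerEnd, h, h']

theorem isLowerSet_lowerEnd (I : PosetInterval Pt) (j : Fin 2) : IsLowerSet (lowerEnd I j) := by
  intro t s hst ht
  by_cases h : Pt.negInf ∈ I.carrier
  · rw [lowerEnd_of_negInf h] at ht ⊢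
    exact mem_of_negInf_mem h hst ht
  by_cases h' : Pt.posInf ∈ I.carrier
  · rw [lowerEnd_of_posInf h h'] at ht ⊢
    exact fun hs => ht (mem_of_posInf_mem h' hst hs)
  match j with
  | 0 =>
    rw [lowerEnd_zero h h'] at ht ⊢
    exact fun u i hu => hst.trans_lt (ht u i hu)
  | 1 =>
    rw [lowerEnd_one h h'] at ht ⊢
    obtain ⟨u, i, hu, htu⟩ := ht
    exact ⟨u, i, hu, hst.trans htu⟩

/-- The two ends do not remember the line, hence the need for a point of `I` on line `i`. -/
theorem real_mem_iff (h : Pt.negInf ∉ I.carrier) (h' : Pt.posInf ∉ I.carrier) {s t : ℝ}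
    {i : Fin 2} (hs : Pt.real s i ∈ I.carrier) :
    Pt.real t i ∈ I.carrier ↔ t ∉ lowerEnd I 0 ∧ t ∈ lowerEnd I 1 := by
  rw [lowerEnd_zero h h', lowerEnd_one h h']
  constructor
  · intro ht
    exact ⟨fun h0 => lt_irrefl _ (h0 t i ht), t, i, ht, le_rfl⟩
  · rintro ⟨h0, u', i', hu', hle'⟩
    simp only [Set.mem_ofPred_eq, not_forall, not_lt] at h0
    obtain ⟨u, l, hu, hle⟩ := h0
    obtain rfl := line_unique h h' hs hu
    obtain rfl := line_unique h h' hs hu'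
    exact I.convex _ hu _ hu' _ (Pt.real_le_real.2 ⟨rfl, hle⟩) (Pt.real_le_real.2 ⟨rfl, hle'⟩)

/-- The ends of `J`, moved to the left by `ε`, are below the ends of `I`. -/
def EndsLE (ε : ℝ) (J I : PosetInterval Pt) : Prop :=
  ∀ j, ∀ t ∈ lowerEnd J j, t - ε ∈ lowerEnd I j

/-- An infinite point common to both intervals provides one of the two bounds, and the ends provide
the other. For intervals within a line, the lower ends give one bound and the upper ends the other.
-/
theorem subset_thickening (h : typ I = typ J) {ε : ℝ≥0} (h1 : EndsLE ε J I)
    (h2 : EndsLE ε I J) : I.carrier ⊆ thickening bipathAction ε J.carrier := by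
  intro p hp
  by_cases hI : Pt.negInf ∈ I.carrier
  · have hJ := (negInf_mem_iff h).1 hI
    refine ⟨fun _ => ⟨Pt.negInf, hJ, Pt.negInf_le p⟩, fun _ => ?_⟩
    cases p with
    | negInf => exact ⟨Pt.negInf, ⟨_, hJ, rfl⟩, le_rfl⟩
    | posInf => exact ⟨Pt.posInf, ⟨_, (posInf_mem_iff h).1 hp, rfl⟩, le_rfl⟩
    | real t i =>
      have := h2 i t (by rwa [lowerEnd_of_negInf hI])
      rw [lowerEnd_of_negInf hJ] at this
      refine ⟨Pt.real t i, ⟨_, this, ?_⟩, le_rfl⟩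
      change Pt.real (t - ε + ε) i = _
      rw [sub_add_cancel]
  have hJ : Pt.negInf ∉ J.carrier := fun h' => hI ((negInf_mem_iff h).2 h')
  by_cases hI' : Pt.posInf ∈ I.carrier
  · have hJ' := (posInf_mem_iff h).1 hI'
    refine ⟨fun _ => ?_, fun _ => ⟨Pt.posInf, ⟨_, hJ', rfl⟩, Pt.le_posInf p⟩⟩
    cases p with
    | negInf => exact absurd hp hI
    | posInf => exact ⟨Pt.posInf, hJ', le_rfl⟩
    | real t i =>
      refine ⟨Pt.real t i, ?_, le_rfl⟩
      change Pt.real (t + ε) i ∈ J.carrier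
      by_contra hn
      have := h1 i (t + ε) (by rwa [lowerEnd_of_posInf hJ hJ'])
      rw [lowerEnd_of_posInf hI hI', add_sub_cancel_right] at this
      exact this hp
  have hJ' : Pt.posInf ∉ J.carrier := fun h' => hI' ((posInf_mem_iff h).2 h')
  obtain ⟨t, i, rfl⟩ := exists_real_mem hI hI' hp
  have hline : ∀ {u j}, Pt.real u j ∈ J.carrier → i = j := fun hu => line_eq h hI hI' hp hu
  have ht := (real_mem_iff hI hI' hp).1 hp
  constructor
  · intro _
    have hn : t + ε ∉ lowerEnd J 0 := fun hn => ht.1 (by simpa using h1 0 _ hn)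
    rw [lowerEnd_zero hJ hJ'] at hn
    simp only [Set.mem_ofPred_eq, not_forall, not_lt] at hn
    obtain ⟨u, l, hu, hle⟩ := hn
    obtain rfl := hline hu
    refine ⟨Pt.real (u - ε) i, ?_, Pt.real_le_real.2 ⟨rfl, by linarith⟩⟩
    change Pt.real (u - ε + ε) i ∈ J.carrier
    rwa [sub_add_cancel]
  · intro _
    have hn := h2 1 t ht.2
    rw [lowerEnd_one hJ hJ'] at hn
    obtain ⟨u, l, hu, hle⟩ := hn
    obtain rfl := hline hu
    exact ⟨Pt.real (u + ε) i, ⟨_, hu, rfl⟩, Pt.real_le_real.2 ⟨rfl, by linarith⟩⟩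

/-- The linear preorder on intervals used to triangularize interleavings. -/
def score (I : PosetInterval Pt) : CutGroup := cut (lowerEnd I 0) + cut (lowerEnd I 1)

/-- If both alternatives fail, some end drops by more than `ε` from `I` to `J`, and some end drops
by more than `ε` from `J` to `K`, while no end ever rises by more than `ε`. The sum of the two ends
is then strictly smaller for `K` than for `I`. -/
theorem endsLE_or_endsLE {ε : ℝ} (hε : 0 ≤ ε) {K : PosetInterval Pt} (h1 : EndsLE ε J I)
    (h2 : EndsLE ε K J) (h : score I ≤ score K) : EndsLE ε I J ∨ EndsLE ε J K := by
  by_contra! hn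
  simp only [EndsLE, not_forall] at hn
  obtain ⟨⟨a, t, ht, ht'⟩, b, r, hr, hr'⟩ := hn
  have e1 := cut_add_lt (isLowerSet_lowerEnd I a) (isLowerSet_lowerEnd J a) ht ht'
  have e2 := cut_add_lt (isLowerSet_lowerEnd J b) (isLowerSet_lowerEnd K b) hr hr'
  have e3 : ∀ j, cut (lowerEnd J j) ≤ cut (lowerEnd I j) + cutShift ε := fun j =>
    cut_le_add (isLowerSet_lowerEnd I j) hε (h1 j)
  have e4 : ∀ j, cut (lowerEnd K j) ≤ cut (lowerEnd J j) + cutShift ε := fun j =>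
    cut_le_add (isLowerSet_lowerEnd J j) hε (h2 j)
  refine absurd h (not_le_of_gt ?_)
  -- Both drops at the same end: that end falls by more than `2γ`, the other rises by at most `2γ`.
  have key : ∀ x0 x1 y0 y1 z0 z1 γ : CutGroup, y0 + γ < x0 → z0 + γ < y0 → y1 ≤ x1 + γ →
      z1 ≤ y1 + γ → z0 + z1 < x0 + x1 := by
    intro x0 x1 y0 y1 z0 z1 γ a1 a2 a3 a4
    grind
  -- Drops at different ends: at each end the drop outweighs the rise in the other step, so both
  -- ends fall.
  have key' : ∀ x0 x1 y0 y1 z0 z1 γ : CutGroup, y0 + γ < x0 → z1 + γ < y1 → y1 ≤ x1 + γ →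
      z0 ≤ y0 + γ → z0 + z1 < x0 + x1 := by
    intro x0 x1 y0 y1 z0 z1 γ a1 a2 a3 a4
    grind
  unfold score
  match a, b with
  | 0, 0 => exact key _ _ _ _ _ _ _ e1 e2 (e3 1) (e4 1)
  | 1, 1 =>
    rw [add_comm (cut (lowerEnd K 0)), add_comm (cut (lowerEnd I 0))]
    exact key _ _ _ _ _ _ _ e1 e2 (e3 0) (e4 0)
  | 0, 1 => exact key' _ _ _ _ _ _ _ e1 e2 (e3 1) (e4 0)
  | 1, 0 =>
    rw [add_comm (cut (lowerEnd K 0)), add_comm (cut (lowerEnd I 0))]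
    exact key' _ _ _ _ _ _ _ e1 e2 (e3 0) (e4 1)

/-- This lets a product of two nonzero entries be read off at any single point `p` where the
composite from `I` to `K` is visible. -/
theorem translate_mem_of_endsLE {ε : ℝ≥0} {K : PosetInterval Pt} (hIJ : typ I = typ J)
    (hIK : typ I = typ K) (h1 : EndsLE ε J I) (h2 : EndsLE ε K J) {p : Pt}
    (hp : p ∈ I.carrier) (hp' : Pt.translate ε (Pt.translate ε p) ∈ K.carrier)
    (hne : ∃ q, q ∈ J.carrier) : Pt.translate ε p ∈ J.carrier := by
  cases p with
  | negInf => exact (negInf_mem_iff hIJ).1 hp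
  | posInf => exact (posInf_mem_iff hIJ).1 hp
  | real t i =>
    change Pt.real (t + ε) i ∈ J.carrier
    change Pt.real (t + ε + ε) i ∈ K.carrier at hp'
    by_cases hI : Pt.negInf ∈ I.carrier
    · have := h2 i (t + ε + ε) (by rwa [lowerEnd_of_negInf ((negInf_mem_iff hIK).1 hI)])
      rwa [lowerEnd_of_negInf ((negInf_mem_iff hIJ).1 hI), add_sub_cancel_right] at this
    have hJ : Pt.negInf ∉ J.carrier := fun h' => hI ((negInf_mem_iff hIJ).2 h')
    have hK : Pt.negInf ∉ K.carrier := fun h' => hI ((negInf_mem_iff hIK).2 h')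
    by_cases hI' : Pt.posInf ∈ I.carrier
    · have hJ' := (posInf_mem_iff hIJ).1 hI'
      by_contra hn
      have := h1 i (t + ε) (by rwa [lowerEnd_of_posInf hJ hJ'])
      rw [lowerEnd_of_posInf hI hI', add_sub_cancel_right] at this
      exact this hp
    have hJ' : Pt.posInf ∉ J.carrier := fun h' => hI' ((posInf_mem_iff hIJ).2 h')
    have hK' : Pt.posInf ∉ K.carrier := fun h' => hI' ((posInf_mem_iff hIK).2 h')
    obtain ⟨q, hq⟩ := hne
    obtain ⟨s, j, rfl⟩ := exists_real_mem hJ hJ' hq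
    obtain rfl := line_eq hIJ hI hI' hp hq
    rw [real_mem_iff hJ hJ' hq]
    refine ⟨fun hn => ((real_mem_iff hI hI' hp).1 hp).1 (by simpa using h1 0 _ hn), ?_⟩
    simpa using h2 1 _ ((real_mem_iff hK hK' hp').1 hp').2

/-- A common infinite point is fixed by translation and serves as `p`. Within a line, if no such `p`
existed, `K` moved left by `2ε` would lie strictly below `I`; as both intervals are long, both ends
of `K` would be strictly below those of `I`, against the scores. -/
theorem exists_mem_of_score_le {ε : ℝ≥0} {K : PosetInterval Pt} (hIK : typ I = typ K)
    (h1 : EndsLE ε J I) (h2 : EndsLE ε K J) (h : score I ≤ score K)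
    (hI : ∃ p ∈ I.carrier, Pt.translate ε (Pt.translate ε p) ∈ I.carrier)
    (hK : ∃ p ∈ K.carrier, Pt.translate ε (Pt.translate ε p) ∈ K.carrier) :
    ∃ p ∈ I.carrier, Pt.translate ε (Pt.translate ε p) ∈ K.carrier := by
  by_cases hI0 : Pt.negInf ∈ I.carrier
  · exact ⟨_, hI0, (negInf_mem_iff hIK).1 hI0⟩
  by_cases hI1 : Pt.posInf ∈ I.carrier
  · exact ⟨_, hI1, (posInf_mem_iff hIK).1 hI1⟩
  have hK0 : Pt.negInf ∉ K.carrier := fun h' => hI0 ((negInf_mem_iff hIK).2 h')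
  have hK1 : Pt.posInf ∉ K.carrier := fun h' => hI1 ((posInf_mem_iff hIK).2 h')
  obtain ⟨p, hp, hp'⟩ := hI
  obtain ⟨r, i, rfl⟩ := exists_real_mem hI0 hI1 hp
  obtain ⟨q, hq, hq'⟩ := hK
  obtain ⟨s, j, rfl⟩ := exists_real_mem hK0 hK1 hq
  obtain rfl := line_eq hIK hI0 hI1 hp hq
  change Pt.real (r + ε + ε) i ∈ I.carrier at hp'
  change Pt.real (s + ε + ε) i ∈ K.carrier at hq'
  by_contra! hn
  have hle : ∀ j (t : ℝ), t + ε + ε ∈ lowerEnd K j → t ∈ lowerEnd I j := fun j t ht => by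
    simpa using h1 j _ (h2 j _ ht)
  have key : ∀ t : ℝ, t + ε + ε ∈ lowerEnd K 1 → t ∈ lowerEnd I 0 := by
    intro t ht
    by_contra ht0
    have ht' : Pt.real t i ∈ I.carrier := (real_mem_iff hI0 hI1 hp).2 ⟨ht0, hle 1 t ht⟩
    exact hn _ ht' ((real_mem_iff hK0 hK1 hq).2 ⟨fun h0 => ht0 (hle 0 t h0), ht⟩)
  have hrI := (real_mem_iff hI0 hI1 hp).1 hp
  have hrI' := (real_mem_iff hI0 hI1 hp).1 hp'
  have hsK := (real_mem_iff hK0 hK1 hq).1 hq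
  have hsK' := (real_mem_iff hK0 hK1 hq).1 hq'
  have e0 : cutShift 0 = 0 := rfl
  have l0 : cut (lowerEnd K 0) < cut (lowerEnd I 0) := by
    simpa [e0] using cut_add_lt (δ := 0) (isLowerSet_lowerEnd I 0) (isLowerSet_lowerEnd K 0)
      (key s hsK'.2) (by simpa using hsK.1)
  have l1 : cut (lowerEnd K 1) < cut (lowerEnd I 1) := by
    simpa [e0] using cut_add_lt (δ := 0) (isLowerSet_lowerEnd I 1) (isLowerSet_lowerEnd K 1)
      hrI'.2 (by simpa using fun h' => hrI.1 (key r h'))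
  exact absurd h (not_le_of_gt (add_lt_add l0 l1))

end Types

/-! ### Matrix coefficients of interleavings -/

section Coefficients

variable {k : Type u} [Field k]

/-- The coefficient of a morphism `V ⟶ W(ε)` at `p` from an interval summand of `V` to an interval
summand of `W`. -/
def coef {P : Type v} [PartialOrder P] {Λ : PosetAction P} {ε : ℝ≥0} {V W : PersMod k P}
    (α : V ⟶ shiftModule Λ ε W) (s : IntervalSummand V) (t : IntervalSummand W) (p : P) : k :=
  t.ξ (Λ.shift ε p) ((α.app p).hom (s.e p))

section General

variable {P : Type v} [PartialOrder P] {Λ : PosetAction P} {ε : ℝ≥0} {V W : PersMod k P}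
  {α : V ⟶ shiftModule Λ ε W} {s : IntervalSummand V} {t : IntervalSummand W}

/-- By naturality. It is not assumed that `q` lies in the source interval or the translate of `p` in
the target interval: a nonzero coefficient forces both, and this drives the statements on ends and
types. -/
theorem coef_eq_coef {p q : P} (h : p ≤ q) (hp : p ∈ s.I.carrier)
    (hq : Λ.shift ε q ∈ t.I.carrier) : coef α s t p = coef α s t q := by
  unfold coef
  rw [← s.tr_e h hp, app_tr, tr_shiftModule]
  exact (t.ξ_tr _ hq _).symm

theorem mem_of_coef_ne_zero {p : P} (h : coef α s t p ≠ 0) :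
    p ∈ s.I.carrier ∧ Λ.shift ε p ∈ t.I.carrier := by
  constructor
  · by_contra hp
    exact h (by unfold coef; rw [s.e_eq_zero p hp, map_zero]; exact map_zero _)
  · by_contra hp
    exact h (by unfold coef; rw [t.ξ_eq_zero _ hp]; rfl)

/-- Expanding `α (e x)` in the basis `t` turns one interleaving identity into a matrix identity at
`p`. -/
theorem sum_coef_mul_coef {X : Type w} {Y : Type w'} {s : X → IntervalSummand V}
    {t : Y → IntervalSummand W} (hs : Orthogonal s) (ht : IsIntervalBasis t)
    {β : W ⟶ shiftModule Λ ε V}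
    (hαβ : ∀ p, (α.app p ≫ β.app (Λ.shift ε p) :
      V.obj p ⟶ V.obj (Λ.shift ε (Λ.shift ε p))) =
      V.map (homOfLE ((Λ.le_shift ε p).trans (Λ.le_shift ε _))))
    {x x' : X} {p : P} (hp : p ∈ (s x).I.carrier)
    (hp' : Λ.shift ε (Λ.shift ε p) ∈ (s x').I.carrier) (T : Finset Y)
    (hT : ∀ y, Λ.shift ε p ∈ (t y).I.carrier → y ∈ T) [Decidable (x = x')] :
    ∑ y ∈ T, coef α (s x) (t y) p * coef β (t y) (s x') (Λ.shift ε p) =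
      if x = x' then 1 else 0 := by
  have hle := (Λ.le_shift ε p).trans (Λ.le_shift ε (Λ.shift ε p))
  have h1 : (β.app (Λ.shift ε p)).hom ((α.app p).hom ((s x).e p)) =
      (s x).e (Λ.shift ε (Λ.shift ε p)) :=
    (congrArg (fun f => f.hom ((s x).e p)) (hαβ p)).trans ((s x).tr_e hle hp)
  let w : W.obj (Λ.shift ε p) := (α.app p).hom ((s x).e p)
  have h2 : w = ∑ y ∈ T, coef α (s x) (t y) p • (t y).e (Λ.shift ε p) := ht.eq_sum T hT w
  let g : W.obj (Λ.shift ε p) →ₗ[k] k :=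
    (s x').ξ (Λ.shift ε (Λ.shift ε p)) ∘ₗ (β.app (Λ.shift ε p)).hom
  have h3 : g w = ∑ y ∈ T, coef α (s x) (t y) p * coef β (t y) (s x') (Λ.shift ε p) := by
    rw [h2, map_sum]
    refine Finset.sum_congr rfl fun y _ => ?_
    rw [map_smul, smul_eq_mul]
    rfl
  have h4 : g w = (s x').ξ (Λ.shift ε (Λ.shift ε p)) ((s x).e (Λ.shift ε (Λ.shift ε p))) :=
    congrArg _ h1
  rw [← h3, h4]
  split_ifs with hx
  · subst hx
    exact (s x).ξ_e _ hp'
  · exact hs x' x (Ne.symm hx) _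

end General

section Bipath

variable {ε : ℝ≥0} {V W : PersMod k Pt} {α : V ⟶ shiftModule bipathAction ε W}
  {s : IntervalSummand V} {t : IntervalSummand W}

/-- Coefficients between intervals of the same type do not depend on the point. -/
theorem coef_eq_coef_of_typ_eq (h : typ s.I = typ t.I) {p q : Pt} (hp : p ∈ s.I.carrier)
    (hq : q ∈ s.I.carrier) (hp' : Pt.translate ε p ∈ t.I.carrier)
    (hq' : Pt.translate ε q ∈ t.I.carrier) : coef α s t p = coef α s t q := by
  by_cases h0 : Pt.negInf ∈ s.I.carrier
  · rw [← coef_eq_coef (Pt.negInf_le p) h0 hp', coef_eq_coef (Pt.negInf_le q) h0 hq']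
  by_cases h1 : Pt.posInf ∈ s.I.carrier
  · have ht := (posInf_mem_iff h).1 h1
    rw [coef_eq_coef (Pt.le_posInf p) hp ht, coef_eq_coef (Pt.le_posInf q) hq ht]
  obtain ⟨a, i, rfl⟩ := exists_real_mem h0 h1 hp
  obtain ⟨b, j, rfl⟩ := exists_real_mem h0 h1 hq
  obtain rfl := line_unique h0 h1 hp hq
  rcases le_total a b with hab | hab
  · exact coef_eq_coef (Pt.real_le_real.2 ⟨rfl, hab⟩) hp hq'
  · exact (coef_eq_coef (Pt.real_le_real.2 ⟨rfl, hab⟩) hq hp').symm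

theorem endsLE_of_coef_ne_zero (h : typ s.I = typ t.I) {p : Pt} (hp : coef α s t p ≠ 0) :
    EndsLE ε t.I s.I := by
  obtain ⟨hps, hpt⟩ := mem_of_coef_ne_zero hp
  -- The coefficients at `q` and `q'` agree, so if one is nonzero both points see both intervals.
  -- This is applied with `-∞`, `+∞` or `p` as one of the two points.
  have key : ∀ {q q' : Pt}, q ≤ q' → q ∈ s.I.carrier → Pt.translate ε q' ∈ t.I.carrier →
      coef α s t q ≠ 0 ∨ coef α s t q' ≠ 0 → q' ∈ s.I.carrier ∧ Pt.translate ε q ∈ t.I.carrier := by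
    intro q q' hqq' hq hq' hne
    have e := coef_eq_coef (α := α) hqq' hq hq'
    rw [e, or_self] at hne
    exact ⟨(mem_of_coef_ne_zero hne).1, (mem_of_coef_ne_zero (e.trans_ne hne)).2⟩
  intro j τ hτ
  by_cases h0 : Pt.negInf ∈ s.I.carrier
  · have h0' := (negInf_mem_iff h).1 h0
    rw [lowerEnd_of_negInf h0'] at hτ
    rw [lowerEnd_of_negInf h0]
    have hne : coef α s t Pt.negInf ≠ 0 := by
      rwa [coef_eq_coef (Pt.negInf_le p) h0 hpt]
    refine (key (Pt.negInf_le _) h0 ?_ (Or.inl hne)).1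
    change Pt.real (τ - ε + ε) j ∈ _
    rwa [sub_add_cancel]
  have h0' : Pt.negInf ∉ t.I.carrier := fun h' => h0 ((negInf_mem_iff h).2 h')
  by_cases h1 : Pt.posInf ∈ s.I.carrier
  · have h1' := (posInf_mem_iff h).1 h1
    rw [lowerEnd_of_posInf h0' h1'] at hτ
    rw [lowerEnd_of_posInf h0 h1]
    intro hn
    have hne : coef α s t Pt.posInf ≠ 0 := by
      rwa [← coef_eq_coef (Pt.le_posInf p) hps h1']
    have := (key (Pt.le_posInf _) hn h1' (Or.inr hne)).2
    change Pt.real (τ - ε + ε) j ∈ _ at this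
    rw [sub_add_cancel] at this
    exact hτ this
  have h1' : Pt.posInf ∉ t.I.carrier := fun h' => h1 ((posInf_mem_iff h).2 h')
  obtain ⟨r, l, rfl⟩ := exists_real_mem h0 h1 hps
  change Pt.real (r + ε) l ∈ _ at hpt
  match j with
  | 0 =>
    rw [lowerEnd_zero h0' h1'] at hτ
    rw [lowerEnd_zero h0 h1]
    intro x i hx
    by_contra! hle
    obtain rfl := line_unique h0 h1 hps hx
    have hxr : x ≤ r := by linarith [hτ _ _ hpt]
    have := (key (Pt.real_le_real.2 ⟨rfl, hxr⟩) hx hpt (Or.inr hp)).2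
    linarith [hτ _ _ this]
  | 1 =>
    rw [lowerEnd_one h0' h1'] at hτ
    rw [lowerEnd_one h0 h1]
    obtain ⟨x, i, hx, hle⟩ := hτ
    obtain rfl := line_unique h0' h1' hpt hx
    rcases le_total (τ - ε) r with h2 | h2
    · exact ⟨r, l, hps, h2⟩
    · refine ⟨x - ε, l, (key (Pt.real_le_real.2 ⟨rfl, (by linarith : r ≤ x - ε)⟩) hps ?_
        (Or.inl hp)).1, by linarith⟩
      change Pt.real (x - ε + ε) l ∈ _
      rwa [sub_add_cancel]

/-- Nonzero coefficients carry membership of `-∞` from source to target and membership of `+∞` from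
target to source. Since `s` and `s'` have the same type, this fixes the type of the interval between
them, so other types contribute nothing to the matrix product. -/
theorem typ_eq_of_coef_ne_zero {β : W ⟶ shiftModule bipathAction ε V} {s' : IntervalSummand V}
    (h : typ s.I = typ s'.I) {p : Pt} (hα : coef α s t p ≠ 0)
    (hβ : coef β t s' (Pt.translate ε p) ≠ 0) : typ s.I = typ t.I := by
  obtain ⟨h1, h2⟩ := mem_of_coef_ne_zero hα
  obtain ⟨-, h4⟩ := mem_of_coef_ne_zero hβ
  refine typ_eq_typ ⟨fun h0 => ?_, fun h0 => ?_⟩ ⟨fun h0 => ?_, fun h0 => ?_⟩ fun h5 h6 => ?_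
  · rw [← coef_eq_coef (Pt.negInf_le p) h0 h2] at hα
    exact (mem_of_coef_ne_zero hα).2
  · rw [← coef_eq_coef (Pt.negInf_le _) h0 h4] at hβ
    exact (negInf_mem_iff h).2 (mem_of_coef_ne_zero hβ).2
  · have h0' : bipathAction.shift ε Pt.posInf ∈ s'.I.carrier := (posInf_mem_iff h).1 h0
    rw [coef_eq_coef (p := Pt.translate ε p) (Pt.le_posInf _) h2 h0'] at hβ
    exact (mem_of_coef_ne_zero hβ).1
  · rw [coef_eq_coef (Pt.le_posInf p) h1 h0] at hα
    exact (mem_of_coef_ne_zero hα).1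
  · obtain ⟨r, i, rfl⟩ := exists_real_mem h5 h6 h1
    exact ⟨r, r + ε, i, h1, h2⟩

open Classical in
/-- The matrix entry of a morphism `V ⟶ W(ε)` between interval summands: the common value of the
coefficients if the intervals have the same type, and `0` otherwise. -/
def entry (α : V ⟶ shiftModule bipathAction ε W) (s : IntervalSummand V) (t : IntervalSummand W) :
    k :=
  if h : typ s.I = typ t.I ∧ ∃ p, coef α s t p ≠ 0 then coef α s t h.2.choose else 0

theorem entry_eq_coef (h : typ s.I = typ t.I) {p : Pt} (hp : p ∈ s.I.carrier)
    (hp' : Pt.translate ε p ∈ t.I.carrier) : entry α s t = coef α s t p := by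
  unfold entry
  split_ifs with h'
  · obtain ⟨h1, h2⟩ := mem_of_coef_ne_zero h'.2.choose_spec
    exact coef_eq_coef_of_typ_eq h h1 hp h2 hp'
  · by_contra hne
    exact h' ⟨h, p, Ne.symm hne⟩

theorem of_entry_ne_zero (h : entry α s t ≠ 0) : typ s.I = typ t.I ∧ EndsLE ε t.I s.I := by
  unfold entry at h
  split_ifs at h with h'
  · exact ⟨h'.1, endsLE_of_coef_ne_zero h'.1 h'.2.choose_spec⟩
  · exact absurd rfl h

end Bipath

end Coefficients

/-! ### Stability -/

section Stability

variable {k : Type u} [Field k] {ε : ℝ≥0} {V W : PersMod k Pt}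

/-- The intervals lie in the thickenings of each other. -/
def Close (ε : ℝ≥0) (I J : PosetInterval Pt) : Prop :=
  I.carrier ⊆ thickening bipathAction ε J.carrier ∧ J.carrier ⊆ thickening bipathAction ε I.carrier

theorem close_of_endsLE {I J : PosetInterval Pt} (h : typ I = typ J) (h1 : EndsLE ε J I)
    (h2 : EndsLE ε I J) : Close ε I J :=
  ⟨subset_thickening h h1 h2, subset_thickening h.symm h2 h1⟩

/-- An interval containing a point and its translate by `2ε`. -/
def Long (ε : ℝ≥0) (I : PosetInterval Pt) : Prop :=
  ∃ p ∈ I.carrier, Pt.translate ε (Pt.translate ε p) ∈ I.carrier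

theorem translate_le_translate {p q : Pt} :
    Pt.translate ε p ≤ Pt.translate ε q ↔ p ≤ q := by
  refine ⟨fun h => ?_, fun h => Pt.translate_monotone ε h⟩
  cases p with
  | negInf => exact Pt.negInf_le q
  | posInf =>
    cases q with
    | negInf => exact absurd (Pt.le_negInf.1 h) (by simp [Pt.translate])
    | posInf => exact le_rfl
    | real t j => exact absurd (Pt.posInf_le.1 h) (by simp [Pt.translate])
  | real s i =>
    cases q with
    | negInf => exact absurd (Pt.le_negInf.1 h) (by simp [Pt.translate])
    | posInf => exact Pt.le_posInf _
    | real t j =>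
      have := Pt.real_le_real.1 h
      exact Pt.real_le_real.2 ⟨this.1, by linarith [this.2]⟩

/-- Translations are surjective, so the preimage of a nonempty set is nonempty and the convention
for empty sets in `up` and `down` plays no role. -/
theorem exists_le_of_mem_thickening {p : Pt} {A : Set Pt}
    (hp : p ∈ thickening bipathAction ε A) (hA : A.Nonempty) :
    (∃ a ∈ A, a ≤ Pt.translate ε p) ∧ ∃ a ∈ A, p ≤ Pt.translate ε a := by
  have hsurj : ∀ a, ∃ b, Pt.translate ε b = a := by
    intro a
    cases a with
    | negInf => exact ⟨.negInf, rfl⟩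
    | posInf => exact ⟨.posInf, rfl⟩
    | real t i => exact ⟨.real (t - ε) i, by simp [Pt.translate]⟩
  constructor
  · obtain ⟨a, ha⟩ := hA
    obtain ⟨b, rfl⟩ := hsurj a
    obtain ⟨c, hc, hcp⟩ := hp.1 ⟨b, ha⟩
    exact ⟨_, hc, translate_le_translate.2 hcp⟩
  · obtain ⟨_, ⟨a, ha, rfl⟩, hle⟩ := hp.2 (hA.image _)
    exact ⟨a, ha, hle⟩

/-- All intervals close to a given long one share a point, so by pointwise finiteness only finitely
many summands are close to it, as Hall's theorem requires. -/
theorem Close.translate_mem {I J : PosetInterval Pt} (h : Close ε I J) {p : Pt}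
    (hp : p ∈ I.carrier) (hp' : Pt.translate ε (Pt.translate ε p) ∈ I.carrier) :
    Pt.translate ε p ∈ J.carrier := by
  obtain ⟨a, ha, hle⟩ := (exists_le_of_mem_thickening (h.1 hp) J.nonempty).1
  obtain ⟨b, hb, hle'⟩ := (exists_le_of_mem_thickening (h.1 hp') J.nonempty).2
  exact J.convex a ha b hb _ hle (translate_le_translate.1 hle')

/-- If no `p` in the first interval has its `2ε`-translate in the second, every product of entries
vanishes by `exists_mem_of_score_le`. Otherwise the products of entries are the products of
coefficients at `p`, whose full sum is known. By `endsLE_or_endsLE`, indices outside `N` contribute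
zero. -/
theorem sum_entry_mul_entry {X : Type w} {Y : Type w'} {s : X → IntervalSummand V}
    {t : Y → IntervalSummand W} (hs : Orthogonal s) (ht : IsIntervalBasis t) (hW : IsPfd W)
    {α : V ⟶ shiftModule bipathAction ε W} {β : W ⟶ shiftModule bipathAction ε V}
    (hαβ : ∀ p, (α.app p ≫ β.app (bipathAction.shift ε p) :
      V.obj p ⟶ V.obj (bipathAction.shift ε (bipathAction.shift ε p))) =
      V.map (homOfLE ((bipathAction.le_shift ε p).trans (bipathAction.le_shift ε _))))
    {x x' : X} (hx : Long ε (s x).I) (hx' : Long ε (s x').I)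
    (hscore : score (s x).I ≤ score (s x').I) (N : Finset Y)
    (hN : ∀ y, Close ε (s x).I (t y).I ∨ Close ε (s x').I (t y).I → y ∈ N)
    [Decidable (x = x')] :
    ∑ y ∈ N, entry α (s x) (t y) * entry β (t y) (s x') = if x = x' then 1 else 0 := by
  classical
  by_cases htyp : typ (s x).I = typ (s x').I
  swap
  · rw [if_neg fun h => htyp (by rw [h])]
    refine Finset.sum_eq_zero fun y _ => ?_
    by_contra hne
    exact htyp ((of_entry_ne_zero (left_ne_zero_of_mul hne)).1.trans
      (of_entry_ne_zero (right_ne_zero_of_mul hne)).1)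
  by_cases hp : ∃ p ∈ (s x).I.carrier, Pt.translate ε (Pt.translate ε p) ∈ (s x').I.carrier
  swap
  · rw [if_neg fun h => hp (by rw [← h]; exact hx)]
    refine Finset.sum_eq_zero fun y _ => ?_
    by_contra hne
    exact hp (exists_mem_of_score_le htyp (of_entry_ne_zero (left_ne_zero_of_mul hne)).2
      (of_entry_ne_zero (right_ne_zero_of_mul hne)).2 hscore hx hx')
  obtain ⟨p, hp, hp'⟩ := hp
  have hfin := ht.1.finite hW (Pt.translate ε p)
  rw [← sum_coef_mul_coef hs ht hαβ hp hp' (N ∪ hfin.toFinset)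
    (fun y hy => Finset.mem_union_right _ (hfin.mem_toFinset.2 hy))]
  rw [Finset.sum_subset (Finset.subset_union_left (s₂ := hfin.toFinset))]
  · refine Finset.sum_congr rfl fun y _ => ?_
    by_cases hy : Pt.translate ε p ∈ (t y).I.carrier
    · by_cases hty : typ (s x).I = typ (t y).I
      · rw [entry_eq_coef hty hp hy, entry_eq_coef (hty.symm.trans htyp) hy hp']
        rfl
      · have h1 : entry α (s x) (t y) = 0 := by
          by_contra hne
          exact hty (of_entry_ne_zero hne).1
        rw [h1, zero_mul]
        by_contra hne
        exact hty (typ_eq_of_coef_ne_zero htyp (left_ne_zero_of_mul (Ne.symm hne))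
          (right_ne_zero_of_mul (Ne.symm hne)))
    · have h1 : coef α (s x) (t y) p = 0 := by
        by_contra hne
        exact hy (mem_of_coef_ne_zero hne).2
      rw [h1, zero_mul]
      by_contra hne
      obtain ⟨e1, e2⟩ := of_entry_ne_zero (left_ne_zero_of_mul hne)
      obtain ⟨e3, e4⟩ := of_entry_ne_zero (right_ne_zero_of_mul hne)
      exact hy (translate_mem_of_endsLE e1 htyp e2 e4 hp hp' (t y).I.nonempty)
  · intro y _ hy
    by_contra hne
    obtain ⟨e1, e2⟩ := of_entry_ne_zero (left_ne_zero_of_mul hne)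
    obtain ⟨e3, e4⟩ := of_entry_ne_zero (right_ne_zero_of_mul hne)
    refine hy (hN y ?_)
    rcases endsLE_or_endsLE ε.2 e2 e4 hscore with h | h
    · exact Or.inl (close_of_endsLE e1 e2 h)
    · exact Or.inr (close_of_endsLE e3.symm h e4)

/-- An interleaving yields a matching which covers the long intervals of one of the modules. -/
theorem exists_injective_close {X : Type w} {Y : Type w'} {s : X → IntervalSummand V}
    {t : Y → IntervalSummand W} (hs : Orthogonal s) (ht : IsIntervalBasis t) (hW : IsPfd W)
    {α : V ⟶ shiftModule bipathAction ε W} {β : W ⟶ shiftModule bipathAction ε V}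
    (hαβ : ∀ p, (α.app p ≫ β.app (bipathAction.shift ε p) :
      V.obj p ⟶ V.obj (bipathAction.shift ε (bipathAction.shift ε p))) =
      V.map (homOfLE ((bipathAction.le_shift ε p).trans (bipathAction.le_shift ε _)))) :
    ∃ f : {x | Long ε (s x).I} → Y, Function.Injective f ∧
      ∀ x, Close ε (s x.1).I (t (f x)).I := by
  classical
  have hfin : ∀ x : {x | Long ε (s x).I}, {y | Close ε (s x.1).I (t y).I}.Finite := by
    rintro ⟨x, p, hp, hp'⟩
    exact (ht.1.finite hW (Pt.translate ε p)).subset fun y hy => Close.translate_mem hy hp hp'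
  -- Hall's marriage theorem for the closeness relation: the entries between `S` and its neighbours
  -- form two matrices with unitriangular product, so the neighbours are at least as many as `S`.
  obtain ⟨f, hf, hf'⟩ := (Finset.all_card_le_biUnion_card_iff_exists_injective
    fun x => (hfin x).toFinset).1 (by
      intro S
      have := card_le_card_of_unitriangular (S := S)
        (N := S.biUnion fun x => (hfin x).toFinset) (fun x => score (s x.1.1).I)
        (fun x y => entry α (s x.1.1) (t y.1)) (fun y x => entry β (t y.1) (s x.1.1)) ?_ ?_
      · simpa using this
      all_goals
        have key : ∀ x x' : S, score (s x.1.1).I ≤ score (s x'.1.1).I →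
            ∑ y : S.biUnion fun x => (hfin x).toFinset,
              entry α (s x.1.1) (t y.1) * entry β (t y.1) (s x'.1.1) =
              if x.1.1 = x'.1.1 then 1 else 0 := by
          intro x x' h
          rw [Finset.sum_coe_sort (S.biUnion fun x => (hfin x).toFinset)
            fun y => entry α (s x.1.1) (t y) * entry β (t y) (s x'.1.1)]
          refine sum_entry_mul_entry hs ht hW hαβ x.1.2 x'.1.2 h _ ?_
          rintro y (hy | hy)
          · exact Finset.mem_biUnion.2 ⟨x.1, x.2, by simpa using hy⟩
          · exact Finset.mem_biUnion.2 ⟨x'.1, x'.2, by simpa using hy⟩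
      · intro x
        rw [key x x le_rfl, if_pos rfl]
      · intro x x' hne hle
        rw [key x x' hle, if_neg fun h => hne (Subtype.ext (Subtype.ext h))])
  exact ⟨f, hf, fun x => by simpa using hf' x⟩

theorem isTrivial_intervalModule {P : Type v} [PartialOrder P] (Λ : PosetAction P) {ζ : ℝ≥0}
    {I : PosetInterval P} :
    IsTrivial Λ ζ (intervalModule k I) ↔ ∀ p ∈ I.carrier, Λ.shift ζ p ∉ I.carrier := by
  constructor
  · intro h p hp hp'
    have h1 : tr (intervalModule k I) (Λ.le_shift ζ p) = 0 := congrArg ModuleCat.Hom.hom (h p)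
    have h2 := ival_tr I (Λ.le_shift ζ p) (ione k I p)
    rw [h1, LinearMap.zero_apply, map_zero, if_pos ⟨hp, hp'⟩, ival_ione, if_pos hp] at h2
    exact zero_ne_one h2
  · intro h p
    have h1 : tr (intervalModule k I) (Λ.le_shift ζ p) = 0 := by
      ext x
      apply ival_injective
      rw [ival_tr, if_neg fun h' => h p h'.1 h'.2, LinearMap.zero_apply, map_zero]
    exact ModuleCat.hom_ext h1

theorem isTrivial_of_not_long {I : PosetInterval Pt} (h : ¬Long ε I) :
    IsTrivial bipathAction (2 * ε) (intervalModule k I) := by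
  rw [isTrivial_intervalModule]
  intro p hp hp'
  refine h ⟨p, hp, ?_⟩
  rwa [Pt.translate_translate, ← two_mul]

/-- The isometry theorem for interval bases: interleaved modules have matched intervals. -/
theorem exists_matching_of_interleaved (hV : IsPfd V) (hW : IsPfd W) {X : Type w} {Y : Type w'}
    {s : X → IntervalSummand V} {t : Y → IntervalSummand W} (hs : IsIntervalBasis s)
    (ht : IsIntervalBasis t) (h : Interleaved bipathAction ε V W) :
    ∃ σ : X ≃. Y, (∀ x, σ x = none → ¬Long ε (s x).I) ∧
      (∀ y, σ.symm y = none → ¬Long ε (t y).I) ∧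
      ∀ x y, σ x = some y → Close ε (s x).I (t y).I := by
  obtain ⟨α, β, hαβ, hβα⟩ := h
  obtain ⟨f, hf, hf'⟩ := exists_injective_close hs.1 ht hW hαβ
  obtain ⟨g, hg, hg'⟩ := exists_injective_close ht.1 hs hV hβα
  exact exists_pequiv_of_injOn (fun x y => Close ε (s x).I (t y).I) {x | Long ε (s x).I}
    {y | Long ε (t y).I} f hf hf' g hg fun y => ⟨(hg' y).2, (hg' y).1⟩

end Stability

/-! ### Interval modules are indecomposable -/

section Indecomposables

open Limits

variable {k : Type u} [Field k] {P : Type v} [PartialOrder P]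

theorem not_isZero_intervalModule (I : PosetInterval P) : ¬IsZero (intervalModule k I) := by
  intro h
  obtain ⟨p, hp⟩ := I.nonempty
  have h1 : 𝟙 (intervalModule k I) = 0 := h.eq_of_src _ _
  have h2 : ione k I p = 0 := congrArg (fun f => (f.app p).hom (ione k I p)) h1
  have h3 := ival_ione (k := k) I p
  rw [h2, map_zero, if_pos hp] at h3
  exact zero_ne_one h3

/-- Endomorphisms of interval modules are scalars. -/
theorem exists_scalar (I : PosetInterval P) (f : intervalModule k I ⟶ intervalModule k I) :
    ∃ c : k, ∀ p x, ival I p ((f.app p).hom x) = c * ival I p x := by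
  let c : P → k := fun p => ival I p ((f.app p).hom (ione k I p))
  have hle : ∀ {p q}, p ≤ q → p ∈ I.carrier → q ∈ I.carrier → c p = c q := by
    intro p q h hp hq
    have h1 : tr _ h (ione k I p) = ione k I q :=
      ival_injective _ _ (by rw [ival_tr, ival_ione, ival_ione]; simp [hp, hq])
    have h2 : c q = ival I q (tr _ h ((f.app p).hom (ione k I p))) := by
      rw [← app_tr, h1]
    rw [h2, ival_tr, if_pos ⟨hp, hq⟩]
  obtain ⟨p₀, hp₀⟩ := I.nonempty
  have hc : ∀ p ∈ I.carrier, c p₀ = c p := by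
    intro p hp
    induction I.connected p₀ hp₀ p hp with
    | refl => rfl
    | tail _ h ih =>
      obtain ⟨h1, h2, h3⟩ := h
      rw [ih h1]
      exact h3.elim (fun h => hle h h1 h2) fun h => (hle h h2 h1).symm
  refine ⟨c p₀, fun p x => ?_⟩
  by_cases hp : p ∈ I.carrier
  · have hx : x = ival I p x • ione k I p :=
      ival_injective _ _ (by simp [ival_ione, hp])
    rw [hc p hp]
    conv_lhs => rw [hx, map_smul, map_smul, smul_eq_mul, mul_comm]
  · rw [ival_eq_zero _ hp, ival_eq_zero _ hp, mul_zero]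

/-- The idempotent of a decomposition is a scalar `c` with `c * c = c`; one summand vanishes if `c =
0`, the other if `c = 1`. -/
theorem indecomposable_intervalModule (I : PosetInterval P) :
    Indecomposable (intervalModule k I) := by
  refine ⟨not_isZero_intervalModule I, fun Y Z φ => ?_⟩
  let f : intervalModule k I ⟶ intervalModule k I :=
    φ.hom ≫ biprod.fst ≫ biprod.inl ≫ φ.inv
  obtain ⟨c, hc⟩ := exists_scalar I f
  have hff : f ≫ f = f := by simp [f]
  obtain ⟨p, hp⟩ := I.nonempty
  have hcc : c * c = c := by
    have h1 := hc p (ione k I p)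
    have h2 : ival I p ((f.app p).hom ((f.app p).hom (ione k I p))) =
        ival I p ((f.app p).hom (ione k I p)) :=
      congrArg (fun g => ival I p ((g.app p).hom (ione k I p))) hff
    rwa [hc, h1, ival_ione, if_pos hp, mul_one] at h2
  rcases mul_eq_zero.1 (show c * (c - 1) = 0 by rw [mul_sub, hcc, mul_one, sub_self]) with h | h
  · left
    have hf : f = 0 := by
      ext p x
      apply ival_injective
      rw [hc, h, zero_mul]
      exact (map_zero _).symm
    have : 𝟙 Y = biprod.inl ≫ φ.inv ≫ f ≫ φ.hom ≫ biprod.fst := by simp [f]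
    rw [IsZero.iff_id_eq_zero, this, hf]
    simp
  · right
    have hf : f = 𝟙 _ := by
      ext p x
      apply ival_injective
      rw [hc, sub_eq_zero.1 h, one_mul]
      rfl
    have h1 : 𝟙 Z = biprod.inr ≫ φ.inv ≫ f ≫ φ.hom ≫ biprod.snd := by simp [hf]
    rw [IsZero.iff_id_eq_zero, h1]
    simp [f]

/-- An indecomposable module with an interval summand is an interval module. -/
theorem Indecomposable.iso_of_summand {M : PersMod k P} (hM : Indecomposable M)
    (s : IntervalSummand M) : Nonempty (M ≅ intervalModule k s.I) := by
  have hsplit : IsSplitMono s.incl := ⟨⟨⟨s.proj, s.incl_proj⟩⟩⟩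
  have hb := isBilimitBinaryBiconeOfIsSplitMonoOfCokernel (cokernelIsCokernel s.incl)
  rcases hM.2 _ _ (biprod.uniqueUpToIso _ _ hb) with h | h
  · exact absurd h (not_isZero_intervalModule _)
  · have : Epi s.incl := Preadditive.epi_of_isZero_cokernel _ h
    have : IsIso s.incl := isIso_of_epi_of_isSplitMono _
    exact ⟨(asIso s.incl).symm⟩

end Indecomposables

/-! ### Direct sums and isomorphisms -/

section Transport

variable {k : Type u} [Field k] {P : Type v} [PartialOrder P] {V W : PersMod k P}
  {Λ : PosetAction P} {ε : ℝ≥0}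

theorem IsDirectSum.isPfd {ι : Type w} {M : ι → PersMod k P} (h : IsDirectSum V M)
    (hV : IsPfd V) (i : ι) : IsPfd (M i) := by
  classical
  obtain ⟨inj, hinj⟩ := h
  intro p
  have := hV p
  refine Module.Finite.of_injective ((inj i).app p).hom fun x y hxy => ?_
  have key : ∀ z : (M i).obj p, (DirectSum.toModule k ι (V.obj p) fun i => ((inj i).app p).hom)
      (DirectSum.lof k ι (fun i => (M i).obj p) i z) = ((inj i).app p).hom z :=
    fun z => DirectSum.toModule_lof (R := k) (φ := fun i => ((inj i).app p).hom) i z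
  rw [← key, ← key] at hxy
  convert! DirectSum.of_injective (β := fun i => (M i).obj p) i ((hinj p).1 ?_)
  convert! hxy

theorem IsDirectSum.congr {ι : Type w} {M N : ι → PersMod k P} (h : IsDirectSum V M)
    (e : ∀ i, M i ≅ N i) : IsDirectSum V N := by
  classical
  obtain ⟨inj, hinj⟩ := h
  refine ⟨fun i => (e i).inv ≫ inj i, fun p => ?_⟩
  let E : (DirectSum ι fun i => (N i).obj p) ≃ₗ[k] DirectSum ι fun i => (M i).obj p :=
    DFinsupp.mapRange.linearEquiv fun i => ((e i).symm.app p).toLinearEquiv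
  have h1 : (DirectSum.toModule k ι (V.obj p) fun i => (((e i).inv ≫ inj i).app p).hom) =
      (DirectSum.toModule k ι (V.obj p) fun i => ((inj i).app p).hom) ∘ₗ E.toLinearMap := by
    refine DirectSum.linearMap_ext _ fun i => ?_
    ext x
    have h2 : E (DirectSum.lof k ι (fun i => (N i).obj p) i x) =
        DirectSum.lof k ι (fun i => (M i).obj p) i (((e i).inv.app p).hom x) :=
      DFinsupp.mapRange_single (hf := fun i => map_zero _)
    simp only [LinearMap.comp_apply, LinearEquiv.coe_coe]
    rw [h2, DirectSum.toModule_lof, DirectSum.toModule_lof]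
    rfl
  convert! (hinj p).comp E.bijective
  exact congrArg DFunLike.coe h1

theorem IsTrivial.of_iso (e : V ≅ W) (h : IsTrivial Λ ε W) : IsTrivial Λ ε V := by
  intro p
  have h1 := e.hom.naturality (homOfLE (Λ.le_shift ε p))
  rw [h p, Limits.comp_zero] at h1
  have h2 : IsIso (e.hom.app (Λ.shift ε p)) := inferInstance
  rw [← cancel_mono (e.hom.app (Λ.shift ε p)), h1, Limits.zero_comp]

/-- The shift of a morphism. -/
def shiftMap (Λ : PosetAction P) (ε : ℝ≥0) (f : V ⟶ W) : shiftModule Λ ε V ⟶ shiftModule Λ ε W :=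
  Functor.whiskerLeft _ f

theorem shiftMap_comp {X : PersMod k P} (f : V ⟶ W) (g : W ⟶ X) :
    shiftMap Λ ε (f ≫ g) = shiftMap Λ ε f ≫ shiftMap Λ ε g := rfl

/-- The canonical morphism from `V` to its double shift. -/
def toShiftShift (Λ : PosetAction P) (ε : ℝ≥0) (V : PersMod k P) :
    V ⟶ shiftModule Λ ε (shiftModule Λ ε V) where
  app p := V.map (homOfLE ((Λ.le_shift ε p).trans (Λ.le_shift ε _)))
  naturality p q f := by
    change V.map f ≫ V.map _ = V.map _ ≫ V.map _
    rw [← V.map_comp, ← V.map_comp]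
    rfl

theorem toShiftShift_naturality (f : V ⟶ W) :
    f ≫ toShiftShift Λ ε W = toShiftShift Λ ε V ≫ shiftMap Λ ε (shiftMap Λ ε f) := by
  ext1
  funext p
  exact (f.naturality _).symm

theorem interleaved_iff : Interleaved Λ ε V W ↔
    ∃ (α : V ⟶ shiftModule Λ ε W) (β : W ⟶ shiftModule Λ ε V),
      α ≫ shiftMap Λ ε β = toShiftShift Λ ε V ∧ β ≫ shiftMap Λ ε α = toShiftShift Λ ε W := by
  refine exists_congr fun α => exists_congr fun β => and_congr ?_ ?_
  · exact ⟨fun h => NatTrans.ext (funext h), fun h p => congrArg (fun f => f.app p) h⟩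
  · exact ⟨fun h => NatTrans.ext (funext h), fun h p => congrArg (fun f => f.app p) h⟩

theorem toShiftShift_eq_zero (h : IsTrivial Λ (2 * ε) V) : toShiftShift Λ ε V = 0 := by
  ext1
  funext p
  -- The double shift by `ε` is only propositionally the shift by `2 * ε`, so the target point is
  -- generalized before substituting.
  have key : ∀ q (hq : p ≤ q), q = Λ.shift (2 * ε) p → V.map (homOfLE hq) = 0 := by
    rintro q hq rfl
    exact h p
  exact key _ _ ((Λ.shift_shift ε ε p).trans (by rw [← two_mul]))

theorem interleaved_refl (V : PersMod k P) : Interleaved Λ ε V V := by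
  refine ⟨⟨fun p => V.map (homOfLE (Λ.le_shift ε p)), ?_⟩,
    ⟨fun p => V.map (homOfLE (Λ.le_shift ε p)), ?_⟩, fun p => ?_, fun p => ?_⟩
  · intro p q f
    change V.map f ≫ V.map _ = V.map _ ≫ V.map _
    rw [← V.map_comp, ← V.map_comp]
    rfl
  · intro p q f
    change V.map f ≫ V.map _ = V.map _ ≫ V.map _
    rw [← V.map_comp, ← V.map_comp]
    rfl
  all_goals
    exact (V.map_comp _ _).symm

theorem Interleaved.of_iso {V' W' : PersMod k P} (e : V' ≅ V) (f : W' ≅ W)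
    (h : Interleaved Λ ε V W) : Interleaved Λ ε V' W' := by
  rw [interleaved_iff] at h ⊢
  obtain ⟨α, β, h1, h2⟩ := h
  have key : ∀ {X Y : PersMod k P} (g : X ≅ Y),
      shiftMap Λ ε g.inv ≫ shiftMap Λ ε g.hom = 𝟙 _ := fun g => by
    rw [← shiftMap_comp, g.inv_hom_id]; rfl
  have key2 : ∀ {X Y : PersMod k P} (g : X ≅ Y),
      g.hom ≫ toShiftShift Λ ε Y ≫ shiftMap Λ ε (shiftMap Λ ε g.inv) = toShiftShift Λ ε X :=
    fun g => by rw [← toShiftShift_naturality, g.hom_inv_id_assoc]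
  refine ⟨e.hom ≫ α ≫ shiftMap Λ ε f.inv, f.hom ≫ β ≫ shiftMap Λ ε e.inv, ?_, ?_⟩
  · simp only [shiftMap_comp, Category.assoc]
    rw [reassoc_of% (key f), reassoc_of% h1, key2]
  · simp only [shiftMap_comp, Category.assoc]
    rw [reassoc_of% (key e), reassoc_of% h2, key2]

/-- A bottleneck interleaving between summands yields an interleaving of the direct sums. -/
theorem BottleneckInterleaved.interleaved {ι : Type w} {κ : Type w'} {M : ι → PersMod k P}
    {N : κ → PersMod k P} (hM : IsDirectSum V M) (hN : IsDirectSum W N)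
    (h : BottleneckInterleaved Λ ε M N) : Interleaved Λ ε V W := by
  classical
  obtain ⟨σ, hσ1, hσ2, hσ⟩ := h
  simp only [interleaved_iff] at hσ
  choose a b hab hba using hσ
  obtain ⟨injM, -, hMdesc, hMext⟩ := hM.exists_desc
  obtain ⟨injN, -, hNdesc, hNext⟩ := hN.exists_desc
  -- On a matched summand the morphism goes through its partner; on an unmatched one it is zero,
  -- which is correct because the map of that summand to its double shift is zero.
  have hα : ∀ i, ∃ f : M i ⟶ shiftModule Λ ε W,
      (σ i = none → f = 0) ∧ ∀ j h, f = a i j h ≫ shiftMap Λ ε (injN j) := by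
    intro i
    rcases Option.eq_none_or_eq_some (σ i) with hi | ⟨j, hi⟩
    · exact ⟨0, fun _ => rfl, fun j h => absurd (hi.symm.trans h) (by simp)⟩
    · refine ⟨a i j hi ≫ shiftMap Λ ε (injN j), fun h => absurd (hi.symm.trans h) (by simp),
        fun j' h => ?_⟩
      obtain rfl : j = j' := Option.some_injective _ (hi.symm.trans h)
      rfl
  have hβ : ∀ j, ∃ f : N j ⟶ shiftModule Λ ε V,
      (σ.symm j = none → f = 0) ∧ ∀ i h, f = b i j h ≫ shiftMap Λ ε (injM i) := by
    intro j
    rcases Option.eq_none_or_eq_some (σ.symm j) with hj | ⟨i, hj⟩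
    · exact ⟨0, fun _ => rfl, fun i h => absurd (hj.symm.trans ((σ.eq_some_iff).2 h)) (by simp)⟩
    · refine ⟨b i j ((σ.eq_some_iff).1 hj) ≫ shiftMap Λ ε (injM i),
        fun h => absurd (hj.symm.trans h) (by simp), fun i' h => ?_⟩
      obtain rfl : i = i' := Option.some_injective _ (hj.symm.trans ((σ.eq_some_iff).2 h))
      rfl
  choose α' hα0 hα1 using hα
  choose β' hβ0 hβ1 using hβ
  obtain ⟨α, hα⟩ := hMdesc _ α'
  obtain ⟨β, hβ⟩ := hNdesc _ β'
  rw [interleaved_iff]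
  refine ⟨α, β, hMext _ _ _ fun i => ?_, hNext _ _ _ fun j => ?_⟩
  · rw [toShiftShift_naturality, reassoc_of% (hα i)]
    cases hi : σ i with
    | none => rw [hα0 i hi, toShiftShift_eq_zero (hσ1 i hi), Limits.zero_comp, Limits.zero_comp]
    | some j =>
      rw [hα1 i j hi, Category.assoc, ← shiftMap_comp, hβ j, hβ1 j i hi, shiftMap_comp,
        reassoc_of% (hab i j hi)]
  · rw [toShiftShift_naturality, reassoc_of% (hβ j)]
    cases hj : σ.symm j with
    | none => rw [hβ0 j hj, toShiftShift_eq_zero (hσ2 j hj), Limits.zero_comp, Limits.zero_comp]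
    | some i =>
      have hi := (σ.eq_some_iff).1 hj
      rw [hβ1 j i hi, Category.assoc, ← shiftMap_comp, hα i, hα1 i j hi, shiftMap_comp,
        reassoc_of% (hba i j hi)]

end Transport

/-! ### Barcodes -/

section Barcodes

variable {k : Type u} [Field k] {V W : PersMod k Pt}

/-- Multiplicities are finite because an interval has a point, and only finitely many basis summands
are alive there. -/
theorem exists_isBarcode (hV : IsPfd V) : ∃ A : Barcode Pt, IsBarcode V A := by
  classical
  obtain ⟨S, hS⟩ := exists_isIntervalBasis V hV
  have hfin : ∀ I : PosetInterval Pt, Finite {s : S // s.1.I = I} := by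
    intro I
    obtain ⟨p, hp⟩ := I.nonempty
    exact ((hS.1.finite hV p).subset fun s (hs : s.1.I = I) => by
      change p ∈ s.1.I.carrier
      rwa [hs]).to_subtype
  let A : Barcode Pt := fun I => Nat.card {s : S // s.1.I = I}
  let e : A.Elem ≃ S := (Equiv.sigmaCongrRight fun I => (Finite.equivFin _).symm).trans
    (Equiv.sigmaFiberEquiv fun s : S => s.1.I)
  have he : ∀ x, (e x).1.I = x.1 := fun x => ((Finite.equivFin _).symm x.2).2
  have hbasis : IsIntervalBasis fun x : A.Elem => (e x).1 :=
    ⟨fun x y hxy => hS.1 _ _ (e.injective.ne hxy), fun p v hv => hS.2 p v fun s => by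
      simpa using hv (e.symm s)⟩
  refine ⟨A, fun x => indecomposable_intervalModule x.1, ?_⟩
  have := hbasis.isDirectSum hV
  simpa only [he] using this

/-- Each `M i` is nonzero and pfd, so it has an interval summand, which is all of it by
indecomposability. -/
theorem IsDecomposition.exists_intervals (hV : IsPfd V) {ι : Type w} {M : ι → PersMod k Pt}
    (h : IsDecomposition V M) : ∃ I : ι → PosetInterval Pt, ∀ i,
      Nonempty (M i ≅ intervalModule k (I i)) := by
  have key : ∀ i, ∃ I, Nonempty (M i ≅ intervalModule k I) := by
    intro i
    have hMi := h.2.isPfd hV i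
    have hne : ∃ p, Nontrivial ((M i).obj p) := by
      by_contra! hn
      refine (h.1 i).1 ?_
      rw [Limits.IsZero.iff_id_eq_zero]
      ext p x
      exact Subsingleton.elim (α := (M i).obj p) _ _
    obtain ⟨p, hp⟩ := hne
    obtain ⟨s⟩ := exists_intervalSummand (M i) hMi p hp
    exact ⟨s.I, Indecomposable.iso_of_summand (h.1 i) s⟩
  choose I hI using key
  exact ⟨I, hI⟩

theorem Close.eq_of_zero {I J : PosetInterval Pt} (h : Close 0 I J) : I = J := by
  have key : ∀ {I J : PosetInterval Pt}, I.carrier ⊆ thickening bipathAction 0 J.carrier →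
      I.carrier ⊆ J.carrier := by
    intro I J h p hp
    obtain ⟨⟨a, ha, hle⟩, b, hb, hle'⟩ := exists_le_of_mem_thickening (h hp) J.nonempty
    rw [Pt.translate_zero] at hle hle'
    exact J.convex a ha b hb p hle hle'
  have hc : I.carrier = J.carrier := (key h.1).antisymm (key h.2)
  cases I
  cases J
  simpa using hc

theorem long_zero (I : PosetInterval Pt) : Long 0 I := by
  obtain ⟨p, hp⟩ := I.nonempty
  exact ⟨p, hp, by rwa [Pt.translate_zero, Pt.translate_zero]⟩

/-- The intervals of a decomposition into interval modules are unique. -/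
theorem exists_equiv_of_isDirectSum (hV : IsPfd V) {ι : Type w} {κ : Type w'}
    {I : ι → PosetInterval Pt} {J : κ → PosetInterval Pt}
    (hI : IsDirectSum V fun i => intervalModule k (I i))
    (hJ : IsDirectSum V fun j => intervalModule k (J j)) :
    ∃ e : ι ≃ κ, ∀ i, J (e i) = I i := by
  obtain ⟨s, hsI, hs⟩ := hI.exists_isIntervalBasis
  obtain ⟨t, htJ, ht⟩ := hJ.exists_isIntervalBasis
  -- At `ε = 0` every interval is long and close intervals are equal, so the matching is a bijection
  -- preserving intervals.
  obtain ⟨σ, h1, h2, h3⟩ := exists_matching_of_interleaved hV hV hs ht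
    (interleaved_refl (ε := 0) V)
  have h1' : ∀ i, ∃ j, σ i = some j := fun i =>
    Option.ne_none_iff_exists'.1 fun h => h1 i h (long_zero _)
  have h2' : ∀ j, ∃ i, σ.symm j = some i := fun j =>
    Option.ne_none_iff_exists'.1 fun h => h2 j h (long_zero _)
  choose f hf using h1'
  choose g hg using h2'
  refine ⟨⟨f, g, fun i => ?_, fun j => ?_⟩, fun i => ?_⟩
  · have := (σ.eq_some_iff).2 (hf i)
    rw [hg] at this
    exact Option.some_injective _ this
  · have := (σ.eq_some_iff).1 (hg j)
    rw [hf] at this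
    exact Option.some_injective _ this
  · rw [← hsI, ← htJ]
    exact (h3 i (f i) (hf i)).eq_of_zero.symm

open Classical in
variable (k) in
/-- The identity of `k` from the interval module of `I` at `p` to the one of `J` at the translate
of `p`, where both do not vanish. -/
def transfer (ε : ℝ≥0) (I J : PosetInterval Pt) (p : Pt) :
    (intervalModule k I).obj p →ₗ[k] (intervalModule k J).obj (Pt.translate ε p) :=
  icod (if Pt.translate ε p ∈ J.carrier then ival I p else 0) fun hp => if_neg hp

open Classical in
theorem ival_transfer (ε : ℝ≥0) (I J : PosetInterval Pt) (p : Pt)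
    (x : (intervalModule k I).obj p) : ival J (Pt.translate ε p) (transfer k ε I J p x) =
      if Pt.translate ε p ∈ J.carrier then ival I p x else 0 := by
  rw [transfer, ival_icod]
  split_ifs <;> rfl

theorem Close.symm {ε : ℝ≥0} {I J : PosetInterval Pt} (h : Close ε I J) : Close ε J I :=
  ⟨h.2, h.1⟩

/-- The critical case is `p` in `I` with the translate of `q` in `J`: closeness and convexity then
put `q` in `I` and the translate of `p` in `J`, so both composites are the identity of `k`. -/
theorem Close.transfer_tr {ε : ℝ≥0} {I J : PosetInterval Pt} (h : Close ε I J) {p q : Pt}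
    (hpq : p ≤ q) (x : (intervalModule k I).obj p) : transfer k ε I J q (tr _ hpq x) =
      tr (intervalModule k J) (Pt.translate_monotone ε hpq) (transfer k ε I J p x) := by
  apply ival_injective
  rw [ival_tr, ival_transfer, ival_transfer]
  by_cases hp : p ∈ I.carrier
  · by_cases hq : Pt.translate ε q ∈ J.carrier
    · obtain ⟨a, ha, hle⟩ := (exists_le_of_mem_thickening (h.1 hp) J.nonempty).1
      obtain ⟨b, hb, hle'⟩ := (exists_le_of_mem_thickening (h.2 hq) I.nonempty).2
      have h1 : Pt.translate ε p ∈ J.carrier :=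
        J.convex a ha _ hq _ hle (Pt.translate_monotone ε hpq)
      have h2 : q ∈ I.carrier := I.convex p hp b hb q hpq (translate_le_translate.1 hle')
      simp [hp, hq, h1, h2, ival_tr]
    · simp [hq]
  · have h1 : ival I p x = 0 := ival_eq_zero I hp x
    have h2 : ival I q (tr _ hpq x) = 0 := by rw [ival_tr, if_neg fun h => hp h.1]
    simp [h1, h2]

theorem Close.transfer_transfer {ε : ℝ≥0} {I J : PosetInterval Pt} (h : Close ε I J) (p : Pt)
    (x : (intervalModule k I).obj p) :
    transfer k ε J I (Pt.translate ε p) (transfer k ε I J p x) =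
      tr (intervalModule k I) ((Pt.le_translate ε p).trans (Pt.le_translate ε _)) x := by
  apply ival_injective
  rw [ival_tr, ival_transfer, ival_transfer]
  by_cases hp : p ∈ I.carrier
  · by_cases hp' : Pt.translate ε (Pt.translate ε p) ∈ I.carrier
    · simp [hp, hp', h.translate_mem hp hp']
    · simp [hp']
  · simp [hp, ival_eq_zero]

/-- The canonical morphism between the interval modules of close intervals. -/
def Close.hom {ε : ℝ≥0} {I J : PosetInterval Pt} (h : Close ε I J) :
    intervalModule k I ⟶ shiftModule bipathAction ε (intervalModule k J) :=
  homMk (V := intervalModule k I) (W := shiftModule bipathAction ε (intervalModule k J))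
    (transfer k ε I J) h.transfer_tr

theorem Close.hom_app_hom_app {ε : ℝ≥0} {I J : PosetInterval Pt} (h : Close ε I J) (p : Pt) :
    (h.hom.app p ≫ h.symm.hom.app (Pt.translate ε p) :
      (intervalModule k I).obj p ⟶ (intervalModule k I).obj (Pt.translate ε (Pt.translate ε p))) =
    (intervalModule k I).map (homOfLE ((bipathAction.le_shift ε p).trans
      (bipathAction.le_shift ε _))) := by
  ext x
  exact h.transfer_transfer p x

theorem Close.interleaved {ε : ℝ≥0} {I J : PosetInterval Pt} (h : Close ε I J) :
    Interleaved bipathAction ε (intervalModule k I) (intervalModule k J) :=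
  ⟨h.hom, h.symm.hom, h.hom_app_hom_app, h.symm.hom_app_hom_app⟩

theorem Matched.bottleneckInterleaved {ε : ℝ≥0} {A C : Barcode Pt} {ι : Type w} {κ : Type w'}
    {M : ι → PersMod k Pt} {N : κ → PersMod k Pt} (h : Matched k bipathAction ε A C)
    (e : ι ≃ A.Elem) (f : κ ≃ C.Elem) (he : ∀ i, Nonempty (M i ≅ intervalModule k (e i).1))
    (hf : ∀ j, Nonempty (N j ≅ intervalModule k (f j).1)) :
    BottleneckInterleaved bipathAction ε M N := by
  obtain ⟨σ, h1, h2, h3⟩ := h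
  have hσ : ∀ i, (e.toPEquiv.trans (σ.trans f.symm.toPEquiv)) i = (σ (e i)).map f.symm := by
    intro i
    change (some (e i)).bind (fun x => (σ x).bind f.symm.toPEquiv) = _
    rw [Option.bind_some]
    cases σ (e i) <;> rfl
  have hσ' : ∀ j, (e.toPEquiv.trans (σ.trans f.symm.toPEquiv)).symm j =
      (σ.symm (f j)).map e.symm := by
    intro j
    change ((some (f j)).bind σ.symm).bind e.symm.toPEquiv = _
    rw [Option.bind_some]
    cases σ.symm (f j) <;> rfl
  refine ⟨e.toPEquiv.trans (σ.trans f.symm.toPEquiv), fun i hi => ?_, fun j hj => ?_,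
    fun i j hij => ?_⟩
  · rw [hσ, Option.map_eq_none_iff] at hi
    obtain ⟨φ⟩ := he i
    exact (h1 _ hi).of_iso φ
  · rw [hσ', Option.map_eq_none_iff] at hj
    obtain ⟨φ⟩ := hf j
    exact (h2 _ hj).of_iso φ
  · rw [hσ, Option.map_eq_some_iff] at hij
    obtain ⟨y, hy, rfl⟩ := hij
    obtain ⟨φ⟩ := he i
    obtain ⟨ψ⟩ := hf (f.symm y)
    rw [f.apply_symm_apply] at ψ
    have hc : Close ε (e i).1 y.1 := h3 _ _ hy
    exact hc.interleaved.of_iso φ ψ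

theorem IsBarcode.matched {ε : ℝ≥0} (hV : IsPfd V) (hW : IsPfd W) {A C : Barcode Pt}
    (hA : IsBarcode V A) (hC : IsBarcode W C) (h : Interleaved bipathAction ε V W) :
    Matched k bipathAction ε A C := by
  obtain ⟨s, hsI, hs⟩ := hA.2.exists_isIntervalBasis
  obtain ⟨t, htI, ht⟩ := hC.2.exists_isIntervalBasis
  obtain ⟨σ, h1, h2, h3⟩ := exists_matching_of_interleaved hV hW hs ht h
  refine ⟨σ, fun x hx => ?_, fun y hy => ?_, fun x y hxy => ?_⟩
  · rw [← hsI]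
    exact isTrivial_of_not_long (h1 x hx)
  · rw [← htI]
    exact isTrivial_of_not_long (h2 y hy)
  · rw [← hsI, ← htI]
    exact h3 x y hxy

end Barcodes

end Bipath

end

open Bipath in
theorem theorem4p2 (k : Type u) [Field k] (V W : PersMod k Pt) (hV : IsPfd V) (hW : IsPfd W) :
    (∃ A : Barcode Pt, IsBarcode V A) ∧ (∃ C : Barcode Pt, IsBarcode W C) ∧
    ∀ (A C : Barcode Pt), IsBarcode V A → IsBarcode W C →
    ∀ (ι : Type w) (κ : Type w') (M : ι → PersMod k Pt) (N : κ → PersMod k Pt),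
      IsDecomposition V M → IsDecomposition W N →
      (∀ ε : ℝ≥0, List.TFAE [
        Matched k bipathAction ε A C,
        BottleneckInterleaved bipathAction ε M N,
        Interleaved bipathAction ε V W]) ∧
      interleavingDist bipathAction V W = bottleneckInterleavingDist bipathAction M N ∧
      bottleneckInterleavingDist bipathAction M N = bottleneckDist k bipathAction A C := by
  refine ⟨exists_isBarcode hV, exists_isBarcode hW, fun A C hA hC ι κ M N hM hN => ?_⟩
  obtain ⟨I, hI⟩ := hM.exists_intervals hV
  obtain ⟨J, hJ⟩ := hN.exists_intervals hW
  -- Uniqueness of the intervals identifies an arbitrary indecomposable decomposition with the given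
  -- barcode, so the choice of either is immaterial.
  obtain ⟨e, he⟩ := exists_equiv_of_isDirectSum hV (hM.2.congr fun i => (hI i).some) hA.2
  obtain ⟨f, hf⟩ := exists_equiv_of_isDirectSum hW (hN.2.congr fun j => (hJ j).some) hC.2
  have key : ∀ ε : ℝ≥0, List.TFAE [Matched k bipathAction ε A C,
      BottleneckInterleaved bipathAction ε M N, Interleaved bipathAction ε V W] := by
    intro ε
    tfae_have 1 → 2 := fun h => h.bottleneckInterleaved e f
      (fun i => by rw [he]; exact hI i) fun j => by rw [hf]; exact hJ j
    tfae_have 2 → 3 := fun h => h.interleaved hM.2 hN.2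
    tfae_have 3 → 1 := fun h => hA.matched hV hW hC h
    tfae_finish
  refine ⟨key, iInf_congr fun ε => ?_, iInf_congr fun ε => ?_⟩
  · exact iInf_congr_Prop ((key ε).out 2 1) fun _ => rfl
  · exact iInf_congr_Prop ((key ε).out 1 0) fun _ => rfl
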